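/- Let $G$ be a graph. A ray in $G$ is a one-way infinite path; two rays are equivalent if for every finite set $X$ of vertices they have tails in the same component of $G-X$; the ends of $G$ are the equivalence classes of rays, and $\Omega(G)$ is the set of ends. For a finite set $X$ of vertices and an end $\omega$ let $C(X,\omega)$ be the component of $G-X$ containing a tail of every ray in $\omega$. The set $\Omega(G)$ carries the topology with basis the sets $\{\varphi : C(X,\varphi)=C(X,\omega)\}$, and sets of ends carry the subspace topology. An end is thin if the supremum of the sizes of collections of pairwise disjoint rays in it is finite. A tree-decomposition $(T,(V_t)_{t\in T})$ of $G$ consists of a tree $T$ and sets $V_t\subseteq V(G)$ such that every vertex lies in some $V_t$, both endvertices of every edge lie in a common $V_t$, and $V_{t_1}\cap V_{t_3}\subseteq V_{t_2}$ whenever $t_2$ lies on the $t_1$--$t_3$ path in $T$. It has finite adhesion if $V_x\cap V_y$ is finite for every edge $xy$ of $T$. In this case every end $\omega$ of $G$ orients every edge $xy$ of $T$, namely towards $y$ if $C(V_x\cap V_y,\omega)$ is contained in the union of the sets $V_t$ with $t$ in the component of $T-xy$ containing $y$, and towards $x$ otherwise. This orientation points towards a node of $T$ or towards an end of $T$; in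 the latter case $\omega$ corresponds to that end. The tree-decomposition displays $\Psi\subseteq\Omega(G)$ if $\Psi$ is the set of all ends of $G$ that correspond to an end of $T$ and this correspondence is a bijection from $\Psi$ to $\Omega(T)$. A set of ends is displayable if it is displayed by some tree-decomposition of finite adhesion. Let $T_2$ be the full infinite binary tree, with nodes the finite $0$--$1$-sequences. A binary tree with fat tops $Z$ is a graph with vertex set $T_2\sqcup Z$ whose edges are all edges of $T_2$ together with edges between $Z$ and $T_2$ such that the neighbourhood of each $z\in Z$ consists of infinitely many nodes on some ray of $T_2$ starting at the root. An end of such a graph is rational if it contains a ray of $T_2$ starting at the root whose $0$--$1$-sequence is eventually constant. Then the following hold. 1. There is a binary tree $G$ with uncountably many fat tops such that the thin ends of $G$ are exactly its rational ends, the subspace of thin ends in $\Omega(G)$ is homeomorphic to $\mathbb{Q}$ and is not completely metrizable, and the set of thin ends of $G$ is not displayable. 2. For every graph $G$, every displayable set of ends of $G$ is completely metrizable. -/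

import Mathlib

universe u v

namespace EndSpace

section Ends

variable {V : Type u}

/-- The vertices `u` and `w` lie in a common component of `G - X`. -/
def Joined (G : SimpleGraph V) (X : Set V) (u w : V) : Prop :=
  ∃ p : G.Walk u w, ∀ x ∈ p.support, x ∉ X

theorem Joined.symm {G : SimpleGraph V} {X : Set V} {a b : V} (h : Joined G X a b) :
    Joined G X b a := by
  obtain ⟨p, hp⟩ := h
  exact ⟨p.reverse, fun x hx => hp x (by simpa using hx)⟩

theorem Joined.trans {G : SimpleGraph V} {X : Set V} {a b c : V} (h : Joined G X a b)
    (h' : Joined G X b c) : Joined G X a c := by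
  obtain ⟨p, hp⟩ := h
  obtain ⟨q, hq⟩ := h'
  refine ⟨p.append q, fun x hx => ?_⟩
  rcases SimpleGraph.Walk.mem_support_append_iff p q |>.1 hx with h | h
  · exact hp x h
  · exact hq x h

/-- A ray: a one-way infinite path, given by the sequence of its vertices. -/
structure Ray (G : SimpleGraph V) where
  /-- The vertices of the ray in their order. -/
  vert : ℕ → V
  injective : Function.Injective vert
  adj : ∀ n, G.Adj (vert n) (vert (n + 1))

/-- The `(n+1)`-st vertex of a ray is the value of the ray at `n`. -/
instance (G : SimpleGraph V) : CoeFun (Ray G) (fun _ => ℕ → V) := ⟨Ray.vert⟩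

/-- Two rays are equivalent if for every finite set `X` of vertices
they have tails in the same component of `G - X`. -/
def Ray.Equivalent {G : SimpleGraph V} (r s : Ray G) : Prop :=
  ∀ X : Finset V, ∃ N, ∀ m ≥ N, ∀ n ≥ N, Joined G X (r m) (s n)

theorem Ray.exists_tail {G : SimpleGraph V} (r : Ray G) (X : Finset V) :
    ∃ N, ∀ n ≥ N, r n ∉ X := by
  have hf : {n | r n ∈ X}.Finite := X.finite_toSet.preimage r.injective.injOn
  obtain ⟨N, hN⟩ := hf.bddAbove
  exact ⟨N + 1, fun n hn h => absurd (hN h) (by omega)⟩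

theorem Ray.joined_tail {G : SimpleGraph V} (r : Ray G) (X : Set V) (N : ℕ)
    (hN : ∀ n ≥ N, r n ∉ X) (m : ℕ) (hm : N ≤ m) : Joined G X (r N) (r m) := by
  induction m, hm using Nat.le_induction with
  | base => exact ⟨SimpleGraph.Walk.nil, by simpa using hN N le_rfl⟩
  | succ k hk ih =>
    refine ih.trans ⟨(r.adj k).toWalk, fun x hx => ?_⟩
    have hx' : x = r k ∨ x = r (k + 1) := by simpa using hx
    rcases hx' with rfl | rfl
    · exact hN k hk
    · exact hN (k + 1) (by omega)

theorem Ray.Equivalent.refl {G : SimpleGraph V} (r : Ray G) : r.Equivalent r := fun X => by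
  obtain ⟨N, hN⟩ := r.exists_tail X
  exact ⟨N, fun m hm n hn => (r.joined_tail X N hN m hm).symm.trans (r.joined_tail X N hN n hn)⟩

/-- Equivalence of rays as an equivalence relation. -/
def raySetoid (G : SimpleGraph V) : Setoid (Ray G) where
  r := Ray.Equivalent
  iseqv :=
    { refl := Ray.Equivalent.refl
      symm := fun h X => by
        obtain ⟨N, hN⟩ := h X
        exact ⟨N, fun m hm n hn => (hN n hn m hm).symm⟩
      trans := fun h h' X => by
        obtain ⟨N, hN⟩ := h X
        obtain ⟨M, hM⟩ := h' X
        refine ⟨max N M, fun m hm n hn => ?_⟩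
        exact (hN m (le_trans (le_max_left _ _) hm) (max N M) (le_max_left _ _)).trans
          (hM (max N M) (le_max_right _ _) n (le_trans (le_max_right _ _) hn)) }

/-- The ends of `G`: the equivalence classes of its rays. -/
def GraphEnd (G : SimpleGraph V) : Type u := Quotient (raySetoid G)

/-- The end to which a ray belongs. -/
def Ray.toEnd {G : SimpleGraph V} (r : Ray G) : GraphEnd G := Quotient.mk (raySetoid G) r

/-- For a finite set `X` of vertices, the vertex set of the component `C(X, ω)` of `G - X`
which contains a tail of every `ω`-ray. -/
def liveComp (G : SimpleGraph V) (X : Set V) (ω : GraphEnd G) : Set V :=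
  {w | ∃ r : Ray G, r.toEnd = ω ∧ ∃ N, ∀ n ≥ N, Joined G X w (r n)}

/-- The topology of the end space: the sets `Ω(X, ω)` of all ends living in `C(X, ω)`,
for `X` finite, are the basic open sets. -/
instance endTopology (G : SimpleGraph V) : TopologicalSpace (GraphEnd G) :=
  TopologicalSpace.generateFrom
    {U | ∃ (X : Finset V) (ω : GraphEnd G), U = {φ | liveComp G X φ = liveComp G X ω}}

/-- The degree of an end: the supremum of the sizes of collections of pairwise disjoint rays
belonging to it. -/
noncomputable def endDegree {G : SimpleGraph V} (ω : GraphEnd G) : Cardinal.{u} :=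
  ⨆ F : {F : Set (Ray G) // (∀ r ∈ F, r.toEnd = ω) ∧
      F.Pairwise fun r s => Disjoint (Set.range r) (Set.range s)}, Cardinal.mk F.1

/-- The set of thin ends, the ends of finite degree. -/
def thinEnds (G : SimpleGraph V) : Set (GraphEnd G) := {ω | endDegree ω < Cardinal.aleph0}

end Ends

section TreeDecompositions

/-- Tree-decompositions of a graph. -/
structure TreeDecomposition {V : Type u} (G : SimpleGraph V) where
  /-- The nodes of the decomposition tree. -/
  Node : Type v
  /-- The decomposition tree. -/
  tree : SimpleGraph Node
  isTree : tree.IsTree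
  /-- The part belonging to a node. -/
  part : Node → Set V
  vertex_mem : ∀ x : V, ∃ t, x ∈ part t
  edge_mem : ∀ x y : V, G.Adj x y → ∃ t, x ∈ part t ∧ y ∈ part t
  inter_subset : ∀ (t₁ t₂ t₃ : Node) (p : tree.Walk t₁ t₃), p.IsPath → t₂ ∈ p.support →
    part t₁ ∩ part t₃ ⊆ part t₂

namespace TreeDecomposition

variable {V : Type u} {G : SimpleGraph V} (𝒯 : TreeDecomposition.{u, v} G)

/-- For an edge `xy` of the tree, the separator induced by this edge. -/
def separator (x y : 𝒯.Node) : Set V := 𝒯.part x ∩ 𝒯.part y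

/-- All separators induced by the edges of the tree are finite. -/
def FiniteAdhesion : Prop := ∀ x y, 𝒯.tree.Adj x y → (𝒯.separator x y).Finite

/-- For an edge `xy` of the tree `T`, the component of `T - xy` which contains `y`. -/
def branch (x y : 𝒯.Node) : Set 𝒯.Node :=
  {t | (𝒯.tree.deleteEdges {s(x, y)}).Reachable y t}

/-- For an edge `xy` of the tree `T`, the union of all parts of nodes in the component of `T - xy`
which contains `y`. -/
def side (x y : 𝒯.Node) : Set V := ⋃ t ∈ 𝒯.branch x y, 𝒯.part t

/-- The end `ω` orients the edge `xy` of the tree from `x` to `y`: it lives in a component of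
`G - (V_x ∩ V_y)` on the side of `y`. -/
def Orients (ω : GraphEnd G) (x y : 𝒯.Node) : Prop :=
  𝒯.tree.Adj x y ∧ liveComp G (𝒯.separator x y) ω ⊆ 𝒯.side x y

/-- The end `ω` of `G` corresponds to the end `η` of the tree: every edge of the tree, oriented by
`ω`, points towards `η`. -/
def CorrespondsTo (ω : GraphEnd G) (η : GraphEnd 𝒯.tree) : Prop :=
  ∀ x y, 𝒯.Orients ω x y → ∃ r : Ray 𝒯.tree, r.toEnd = η ∧ ∃ N, ∀ n ≥ N, r n ∈ 𝒯.branch x y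

/-- The boundary of a tree-decomposition: the set of all ends of `G` which correspond to an end
of the tree. -/
def boundary : Set (GraphEnd G) := {ω | ∃ η, 𝒯.CorrespondsTo ω η}

/-- The tree-decomposition displays `Ψ`: its boundary is `Ψ`, and mapping each end in `Ψ` to the
end of the tree to which it corresponds is a bijection from `Ψ` to the set of ends of the tree. -/
def Displays (Ψ : Set (GraphEnd G)) : Prop :=
  𝒯.boundary = Ψ ∧ ∃ f : Ψ → GraphEnd 𝒯.tree, (∀ ψ : Ψ, 𝒯.CorrespondsTo ψ (f ψ)) ∧
    Function.Bijective f

end TreeDecomposition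

/-- The set `Ψ` of ends is displayable: it is displayed by a tree-decomposition of finite
adhesion. -/
def Displayable {V : Type u} (G : SimpleGraph V) (Ψ : Set (GraphEnd G)) : Prop :=
  ∃ 𝒯 : TreeDecomposition.{u, v} G, 𝒯.FiniteAdhesion ∧ 𝒯.Displays Ψ

end TreeDecompositions

section BinaryTrees

/-- The full infinite binary tree: its nodes are the finite `0`-`1`-sequences, and every node is
adjacent to its two extensions by one more entry. The root is the empty sequence. -/
def binaryTree : SimpleGraph (List Bool) := SimpleGraph.fromRel fun s t => ∃ b, t = s ++ [b]

/-- The `n`-th node of the normal ray of the binary tree belonging to the `0`-`1`-sequence `α`. -/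
def normalNode (α : ℕ → Bool) (n : ℕ) : List Bool := (List.range n).map α

/-- The graph `G` is a binary tree with fat tops `Z`: its vertices are those of the binary tree and
the elements of `Z`, its edges are those of the binary tree and edges between the tree and `Z`, and
the neighbourhood of each element of `Z` consists of infinitely many nodes on a normal ray. -/
def IsBinaryTreeWithFatTops {Z : Type u} (G : SimpleGraph (List Bool ⊕ Z)) : Prop :=
  (∀ s t, G.Adj (Sum.inl s) (Sum.inl t) ↔ binaryTree.Adj s t) ∧
  ∀ z : Z, (G.neighborSet (Sum.inr z)).Infinite ∧
    ∃ α : ℕ → Bool, G.neighborSet (Sum.inr z) ⊆ Set.range fun n => Sum.inl (normalNode α n)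

/-- The rational ends of a binary tree with fat tops: the ends which contain a normal ray of the
binary tree whose `0`-`1`-sequence is eventually constant. -/
def rationalEnds {Z : Type u} (G : SimpleGraph (List Bool ⊕ Z)) : Set (GraphEnd G) :=
  {ω | ∃ α : ℕ → Bool, (∃ N, ∀ n ≥ N, α n = α N) ∧
    ∃ r : Ray G, r.toEnd = ω ∧ ∀ n, r n = Sum.inl (normalNode α n)}

end BinaryTrees

end EndSpace

namespace EndSpace

open Filter Topology

/-! ### Components, ends and their neighbourhoods -/

section Ends

variable {V : Type u} {G : SimpleGraph V}

/-! Displayable sets. Root the decomposition tree at a node `o`. An end in the boundary orients the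
edges along a unique geodesic ray from `o`; record, for every `n`, the `n`-th edge of this ray and
the component of `G` minus its finite separator in which the end lives. This embeds the boundary in
a countable power of a discrete space. A coordinate is locally constant, because components
determine orientations. The coordinates induce the topology, because a finite vertex set is avoided
by the components far out (`exists_disjoint_liveComp`). The image is closed, because nested
components along a geodesic ray with empty intersection contain a ray converging through them
(`exists_ray_of_antitone`, `exists_end_of_geodesic`).

The example. In `flipGraph` every sequence that is not eventually constant gets infinitely many
tops, attached where it changes value. The ends correspond to the 0-1 sequences, with the Cantor
topology. At an irrational end, tops and changes form an infinite complete bipartite graph, so the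
end is thick. At a rational end with sequence `α`, a top above a high node of the normal ray reaches
below it only at changes of `α`, and these are boundedly many; hence the end is thin
(`exists_eq_normalNode_of_adj`, `endDegree_le_of_endSeq`). Attaching tops at all nodes would not
give this bound.

The thin ends therefore form the space of eventually constant sequences. Recoded as eventually
alternating sequences and ordered lexicographically, it is a countable dense order without endpoints
carrying its order topology, so it is `ℚ` by Cantor's theorem. By Baire's theorem `ℚ` is not
completely metrizable, and so the thin ends are not displayable. -/

theorem Joined.refl {X : Set V} {a : V} (h : a ∉ X) : Joined G X a a :=
  ⟨SimpleGraph.Walk.nil, by simpa using h⟩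

theorem Joined.of_adj {X : Set V} {a b : V} (h : G.Adj a b) (ha : a ∉ X) (hb : b ∉ X) :
    Joined G X a b :=
  ⟨h.toWalk, fun x hx => by
    have hx' : x = a ∨ x = b := by simpa using hx
    rcases hx' with rfl | rfl <;> assumption⟩

theorem Joined.left_notMem {X : Set V} {a b : V} (h : Joined G X a b) : a ∉ X := by
  obtain ⟨p, hp⟩ := h
  exact hp a p.start_mem_support

theorem Joined.of_mem_support {X : Set V} {a b c : V} {p : G.Walk a b}
    (hp : ∀ x ∈ p.support, x ∉ X) (hc : c ∈ p.support) : Joined G X a c := by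
  classical
  exact ⟨p.takeUntil c hc, fun x hx => hp x (p.support_takeUntil_subset_support hc hx)⟩

/-- A property which is preserved under adjacency outside `X` spreads over components of
`G - X`. -/
theorem Joined.induction {X : Set V} {P : V → Prop} {a b : V} (h : Joined G X a b) (ha : P a)
    (step : ∀ u w, G.Adj u w → u ∉ X → w ∉ X → P u → P w) : P b := by
  obtain ⟨p, hp⟩ := h
  induction p with
  | nil => exact ha
  | cons hadj q ih =>
    refine ih (step _ _ hadj (hp _ (by simp)) (hp _ (by simp)) ha) fun x hx => hp x ?_
    simp [hx]

theorem Ray.eventually_notMem (r : Ray G) {X : Set V} (hX : X.Finite) :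
    ∀ᶠ n in atTop, r n ∉ X := by
  obtain ⟨N, hN⟩ := r.exists_tail hX.toFinset
  exact eventually_atTop.2 ⟨N, fun n hn => by simpa using hN n hn⟩

theorem Ray.toEnd_eq_iff {r s : Ray G} : r.toEnd = s.toEnd ↔ r.Equivalent s :=
  ⟨fun h => Quotient.exact h, fun h => Quotient.sound h⟩

theorem exists_ray (ω : GraphEnd G) : ∃ r : Ray G, r.toEnd = ω := Quotient.exists_rep ω

theorem Ray.Equivalent.joined {r s : Ray G} (h : r.Equivalent s) {X : Set V} (hX : X.Finite) :
    ∃ N, ∀ m ≥ N, ∀ n ≥ N, Joined G X (r m) (s n) := by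
  simpa using h hX.toFinset

/-- Since equivalent rays have tails joined in `G - X`, one fixed ray of the end decides membership;
later arguments can choose the ray freely. -/
theorem mem_liveComp_iff {X : Set V} (hX : X.Finite) (r : Ray G) {w : V} :
    w ∈ liveComp G X r.toEnd ↔ ∀ᶠ n in atTop, Joined G X w (r n) := by
  constructor
  · rintro ⟨s, hs, N, hN⟩
    obtain ⟨M, hM⟩ := (Ray.toEnd_eq_iff.1 hs).joined hX
    exact eventually_atTop.2 ⟨M, fun n hn =>
      (hN (max N M) (le_max_left _ _)).trans (hM _ (le_max_right _ _) n hn)⟩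
  · intro h
    obtain ⟨N, hN⟩ := eventually_atTop.1 h
    exact ⟨r, rfl, N, hN⟩

theorem eventually_mem_liveComp {X : Set V} (hX : X.Finite) (r : Ray G) :
    ∀ᶠ n in atTop, r n ∈ liveComp G X r.toEnd := by
  obtain ⟨N, hN⟩ := (Ray.Equivalent.refl r).joined hX
  exact eventually_atTop.2 ⟨N, fun m hm => (mem_liveComp_iff hX r).2
    (eventually_atTop.2 ⟨N, fun n hn => hN m hm n hn⟩)⟩

theorem notMem_of_mem_liveComp {X : Set V} {ω : GraphEnd G} {w : V} (h : w ∈ liveComp G X ω) :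
    w ∉ X := by
  obtain ⟨r, -, N, hN⟩ := h
  exact (hN N le_rfl).left_notMem

theorem mem_liveComp_of_joined {X : Set V} {ω : GraphEnd G} {w w' : V}
    (h : w ∈ liveComp G X ω) (h' : Joined G X w w') : w' ∈ liveComp G X ω := by
  obtain ⟨r, hr, N, hN⟩ := h
  exact ⟨r, hr, N, fun n hn => h'.symm.trans (hN n hn)⟩

theorem joined_of_mem_liveComp {X : Set V} (hX : X.Finite) {ω : GraphEnd G} {w w' : V}
    (h : w ∈ liveComp G X ω) (h' : w' ∈ liveComp G X ω) : Joined G X w w' := by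
  obtain ⟨r, rfl⟩ := exists_ray ω
  obtain ⟨n, h1, h2⟩ :=
    (((mem_liveComp_iff hX r).1 h).and ((mem_liveComp_iff hX r).1 h')).exists
  exact h1.trans h2.symm

theorem liveComp_eq_of_mem {X : Set V} (hX : X.Finite) {ω : GraphEnd G} {w : V}
    (h : w ∈ liveComp G X ω) : liveComp G X ω = {x | Joined G X w x} :=
  Set.ext fun _ => ⟨fun hx => joined_of_mem_liveComp hX h hx, fun hx => mem_liveComp_of_joined h hx⟩

theorem liveComp_eq_of_common {X : Set V} (hX : X.Finite) {ω φ : GraphEnd G} {w : V}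
    (h : w ∈ liveComp G X ω) (h' : w ∈ liveComp G X φ) : liveComp G X ω = liveComp G X φ := by
  rw [liveComp_eq_of_mem hX h, liveComp_eq_of_mem hX h']

theorem liveComp_nonempty {X : Set V} (hX : X.Finite) (ω : GraphEnd G) :
    (liveComp G X ω).Nonempty := by
  obtain ⟨r, rfl⟩ := exists_ray ω
  obtain ⟨n, hn⟩ := (eventually_mem_liveComp hX r).exists
  exact ⟨_, hn⟩

theorem exists_walk_of_mem_liveComp {X : Set V} (hX : X.Finite) {ω : GraphEnd G} {w w' : V}
    (h : w ∈ liveComp G X ω) (h' : w' ∈ liveComp G X ω) :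
    ∃ p : G.Walk w w', ∀ x ∈ p.support, x ∈ liveComp G X ω := by
  obtain ⟨p, hp⟩ := joined_of_mem_liveComp hX h h'
  exact ⟨p, fun x hx => mem_liveComp_of_joined h (Joined.of_mem_support hp hx)⟩

/-- The component is connected, avoids `X` and contains a tail of a ray of `ω`, so it stays within
one component of `G - X`. -/
theorem liveComp_subset_of_disjoint {S X : Set V} (hS : S.Finite) {ω : GraphEnd G}
    (h : Disjoint (liveComp G S ω) X) : liveComp G S ω ⊆ liveComp G X ω := by
  obtain ⟨r, rfl⟩ := exists_ray ω
  intro w hw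
  obtain ⟨N, hN⟩ := eventually_atTop.1 (eventually_mem_liveComp hS r)
  refine ⟨r, rfl, N, fun n hn => ?_⟩
  obtain ⟨p, hp⟩ := exists_walk_of_mem_liveComp hS hw (hN n hn)
  exact ⟨p, fun x hx => Set.disjoint_left.1 h (hp x hx)⟩

/-- If two ends live in the same component of `G - S` and this component avoids `X`, then they
live in the same component of `G - X`. -/
theorem liveComp_eq_of_disjoint {S X : Set V} (hS : S.Finite) (hX : X.Finite) {ω φ : GraphEnd G}
    (h : Disjoint (liveComp G S ω) X) (hφ : liveComp G S φ = liveComp G S ω) :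
    liveComp G X φ = liveComp G X ω := by
  obtain ⟨w, hw⟩ := liveComp_nonempty hS ω
  exact liveComp_eq_of_common hX (liveComp_subset_of_disjoint hS (hφ ▸ h) (hφ ▸ hw))
    (liveComp_subset_of_disjoint hS h hw)

theorem liveComp_eq_mono {S X : Set V} (hS : S.Finite) (hXS : X ⊆ S) {ω φ : GraphEnd G}
    (hφ : liveComp G S φ = liveComp G S ω) : liveComp G X φ = liveComp G X ω :=
  liveComp_eq_of_disjoint hS (hS.subset hXS)
    (Set.disjoint_left.2 fun _ hx h => notMem_of_mem_liveComp hx (hXS h)) hφ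

/-- The generating sets already form a basis: the set for `X ∪ Y` refines those for `X` and `Y`. -/
theorem GraphEnd.mem_nhds_iff {ω : GraphEnd G} {U : Set (GraphEnd G)} :
    U ∈ 𝓝 ω ↔ ∃ X : Set V, X.Finite ∧ {φ | liveComp G X φ = liveComp G X ω} ⊆ U := by
  classical
  have hopen : ∀ X : Set V, X.Finite → ∀ ω : GraphEnd G,
      IsOpen {φ | liveComp G X φ = liveComp G X ω} := fun X hX ω =>
    TopologicalSpace.isOpen_generateFrom_of_mem ⟨hX.toFinset, ω, by simp⟩
  constructor
  · intro hU
    obtain ⟨O, hOU, hO, hω⟩ := _root_.mem_nhds_iff.1 hU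
    suffices h : ∃ X : Set V, X.Finite ∧ {φ | liveComp G X φ = liveComp G X ω} ⊆ O by
      obtain ⟨X, hX, h⟩ := h
      exact ⟨X, hX, h.trans hOU⟩
    clear hOU hU
    induction hO with
    | basic s hs =>
      obtain ⟨X, ψ, rfl⟩ := hs
      exact ⟨X, X.finite_toSet, fun φ hφ => Eq.trans hφ hω⟩
    | univ => exact ⟨∅, Set.finite_empty, Set.subset_univ _⟩
    | inter s t _ _ ihs iht =>
      obtain ⟨X, hX, h⟩ := ihs hω.1
      obtain ⟨Y, hY, h'⟩ := iht hω.2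
      exact ⟨X ∪ Y, hX.union hY, fun φ hφ =>
        ⟨h (liveComp_eq_mono (hX.union hY) Set.subset_union_left hφ),
          h' (liveComp_eq_mono (hX.union hY) Set.subset_union_right hφ)⟩⟩
    | sUnion S _ ih =>
      obtain ⟨s, hs, hωs⟩ := hω
      obtain ⟨X, hX, h⟩ := ih s hs hωs
      exact ⟨X, hX, h.trans (Set.subset_sUnion_of_mem hs)⟩
  · rintro ⟨X, hX, h⟩
    exact mem_of_superset ((hopen X hX ω).mem_nhds rfl) h

theorem GraphEnd.ext_of_liveComp {ω φ : GraphEnd G}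
    (h : ∀ X : Set V, X.Finite → liveComp G X φ = liveComp G X ω) : φ = ω := by
  obtain ⟨r, rfl⟩ := exists_ray ω
  obtain ⟨s, rfl⟩ := exists_ray φ
  refine Ray.toEnd_eq_iff.2 fun X => ?_
  have hX := X.finite_toSet
  obtain ⟨N, hN⟩ := eventually_atTop.1
    ((eventually_mem_liveComp hX r).and (eventually_mem_liveComp hX s))
  exact ⟨N, fun m hm n hn => joined_of_mem_liveComp hX (h X hX ▸ (hN m hm).2) (hN n hn).1⟩

instance (Ψ : Set (GraphEnd G)) : T0Space Ψ := by
  have : T0Space (GraphEnd G) := by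
    refine ⟨fun φ ω h => GraphEnd.ext_of_liveComp fun X hX => ?_⟩
    have h1 : {ψ : GraphEnd G | liveComp G X ψ = liveComp G X ω} ∈ 𝓝 φ := by
      rw [inseparable_def.1 h]
      exact GraphEnd.mem_nhds_iff.2 ⟨X, hX, le_rfl⟩
    exact (mem_of_mem_nhds h1 :)
  infer_instance

/-- A decreasing sequence of connected vertex sets with empty intersection contains a ray which
has a tail in each of these sets. -/
theorem exists_ray_of_antitone {C : ℕ → Set V} (hne : ∀ n, (C n).Nonempty) (hC : Antitone C)
    (hconn : ∀ n, ∀ u ∈ C n, ∀ w ∈ C n, ∃ p : G.Walk u w, ∀ x ∈ p.support, x ∈ C n)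
    (hempty : ∀ x, ∃ n, x ∉ C n) : ∃ r : Ray G, ∀ n, ∀ᶠ k in atTop, r k ∈ C n := by
  classical
  -- Aim for a point of some `C m` that misses `w`, so that the walk cannot be trivial.
  have hstep : ∀ n, ∀ w : C n, ∃ w' : C (n + 1), ∃ p : G.Walk (w : V) w',
      0 < p.length ∧ ∀ x ∈ p.support, x ∈ C n := by
    intro n w
    obtain ⟨m, hm⟩ := hempty w
    obtain ⟨w', hw'⟩ := hne (max m (n + 1))
    have hw1 : w' ∈ C (n + 1) := hC (le_max_right _ _) hw'
    obtain ⟨p, hp⟩ := hconn n w w.2 w' (hC n.le_succ hw1)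
    refine ⟨⟨w', hw1⟩, p, Nat.pos_of_ne_zero fun h0 => hm ?_, hp⟩
    rw [SimpleGraph.Walk.eq_of_length_eq_zero h0]
    exact hC (le_max_left _ _) hw'
  choose f e he hsupp using hstep
  let u : ∀ n, C n := fun n =>
    Nat.rec (motive := fun n => C n) ⟨_, (hne 0).some_mem⟩ (fun n w => f n w) n
  let q : ∀ n, G.Walk (u 0 : V) (u n) := fun n =>
    Nat.rec (motive := fun n => G.Walk (u 0 : V) (u n)) SimpleGraph.Walk.nil
      (fun n p => (SimpleGraph.Walk.append p (e n (u n)) : G.Walk (u 0 : V) (f n (u n)))) n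
  have hq : ∀ n, q (n + 1) = (q n).append (e n (u n)) := fun n => rfl
  have hlen : ∀ n, (q n).length + 1 ≤ (q (n + 1)).length := fun n => by
    rw [hq, SimpleGraph.Walk.length_append]
    have := he n (u n)
    omega
  have hlenmono : Monotone fun n => (q n).length :=
    monotone_nat_of_le_succ fun n => by have := hlen n; omega
  have hle : ∀ n, n ≤ (q n).length := fun n => by
    induction n with
    | zero => exact Nat.zero_le _
    | succ n ih => have := hlen n; omega
  have hext : ∀ n m, n ≤ m → ∀ k ≤ (q n).length, (q m).getVert k = (q n).getVert k := by
    intro n m hnm k hk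
    induction m, hnm using Nat.le_induction with
    | base => rfl
    | succ m hm ih =>
      rw [hq, SimpleGraph.Walk.getVert_append, ← ih]
      have : (q n).length ≤ (q m).length := hlenmono hm
      rcases hk.trans this |>.lt_or_eq with h | h
      · rw [if_pos h]
      · rw [if_neg (by omega), h]
        simp
  have htail : ∀ n m, n ≤ m → ∀ k, (q n).length ≤ k → (q m).getVert k ∈ C n := by
    intro n m hnm k hk
    induction m, hnm using Nat.le_induction with
    | base =>
      rw [SimpleGraph.Walk.getVert_of_length_le _ hk]
      exact (u n).2
    | succ m hm ih =>
      rw [hq, SimpleGraph.Walk.getVert_append]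
      split_ifs with h
      · exact ih
      · exact hC hm (hsupp m _ _ (SimpleGraph.Walk.getVert_mem_support _ _))
  -- The infinite walk read off diagonally; `q k` has length at least `k`, so its `k`-th vertex is
  -- final.
  let W : ℕ → V := fun k => (q k).getVert k
  have hWq : ∀ k m, k ≤ m → W k = (q m).getVert k := fun k m h => (hext k m h k (hle k)).symm
  have hWadj : ∀ k, G.Adj (W k) (W (k + 1)) := fun k => by
    rw [hWq k (k + 1) k.le_succ]
    exact (q (k + 1)).adj_getVert_succ (by have := hle (k + 1); omega)
  have hWtail : ∀ n k, (q n).length ≤ k → W k ∈ C n := fun n k hk =>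
    htail n k ((hle n).trans hk) k hk
  -- Each vertex is outside some `C n`, hence visited only finitely often. Jumping from each last
  -- visit to the last visit of the following vertex turns the walk into a path.
  have hlast : ∀ k, ∃ l, k ≤ l ∧ W l = W k ∧ ∀ m, l < m → W m ≠ W k := by
    intro k
    obtain ⟨n, hn⟩ := hempty (W k)
    have hb : ∀ m, W m = W k → m ≤ (q n).length := fun m hm => by
      by_contra hlt
      exact hn (hm ▸ hWtail n m (by omega))
    refine ⟨Nat.findGreatest (fun m => W m = W k) (q n).length,
      Nat.le_findGreatest (hb k rfl) rfl,
      Nat.findGreatest_spec (P := fun m => W m = W k) (hb k rfl) rfl, fun m hm heq => ?_⟩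
    exact absurd (Nat.le_findGreatest (P := fun m => W m = W k) (hb m heq) heq) (by omega)
  choose L hL1 hL2 hL3 using hlast
  let κ : ℕ → ℕ := fun i => Nat.rec (L 0) (fun _ k => L (k + 1)) i
  have hκ : StrictMono κ := strictMono_nat_of_lt_succ fun i => hL1 (κ i + 1)
  have hκlast : ∀ i m, κ i < m → W m ≠ W (κ i) := by
    intro i m hm
    cases i with
    | zero => exact fun h => hL3 0 m hm (h.trans (hL2 0))
    | succ i => exact fun h => hL3 (κ i + 1) m hm (h.trans (hL2 _))
  refine ⟨⟨fun i => W (κ i), ?_, fun i => ?_⟩, fun n => ?_⟩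
  · intro i j hij
    rcases lt_trichotomy i j with h | h | h
    · exact absurd hij.symm (hκlast i _ (hκ h))
    · exact h
    · exact absurd hij (hκlast j _ (hκ h))
  · have : W (κ (i + 1)) = W (κ i + 1) := hL2 _
    rw [this]
    exact hWadj _
  · exact eventually_atTop.2 ⟨(q n).length, fun k hk => hWtail n _ (hk.trans hκ.le_apply)⟩

end Ends

/-! ### A criterion for complete metrizability -/

/-- A `T₀` space whose topology is induced by a sequence of locally constant maps is completely
metrizable if every sequence of values which is realised on each initial segment is realised. -/
theorem isCompletelyMetrizableSpace_of_locallyConstant {Y : Type*} [TopologicalSpace Y] [T0Space Y]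
    {D : Type*} (π : ℕ → Y → D) (hloc : ∀ n x, ∀ᶠ y in 𝓝 x, π n y = π n x)
    (hbasis : ∀ x, ∀ U ∈ 𝓝 x, ∃ n, ∀ y, π n y = π n x → y ∈ U)
    (hcompl : ∀ d : ℕ → D, (∀ n, ∃ x, ∀ i ≤ n, π i x = d i) → ∃ x, ∀ n, π n x = d n) :
    TopologicalSpace.IsCompletelyMetrizableSpace Y := by
  let : TopologicalSpace D := ⊥
  have : DiscreteTopology D := ⟨rfl⟩
  have : TopologicalSpace.IsCompletelyMetrizableSpace D := by
    let : UniformSpace D := ⊥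
    infer_instance
  have hcont : Continuous fun y n => π n y := by
    refine continuous_pi fun n => continuous_iff_continuousAt.2 fun x => ?_
    rw [ContinuousAt, nhds_discrete D, tendsto_pure]
    exact hloc n x
  have hind : IsInducing fun y n => π n y := by
    refine isInducing_iff_nhds.2 fun x => le_antisymm hcont.continuousAt.le_comap fun U hU => ?_
    obtain ⟨n, hn⟩ := hbasis x U hU
    refine ⟨{g | g n = π n x}, ?_, fun y hy => hn y hy⟩
    exact (isOpen_discrete {π n x}).preimage (f := fun g : ℕ → D => g n)
      (continuous_apply n) |>.mem_nhds rfl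
  refine Topology.IsClosedEmbedding.IsCompletelyMetrizableSpace
    (f := fun y n => π n y) ⟨hind.isEmbedding, ?_⟩
  -- A point in the closure agrees on every initial segment with a realised sequence, so `hcompl`
  -- applies.
  refine isClosed_of_closure_subset fun d hd => ?_
  obtain ⟨x, hx⟩ := hcompl d fun n => by
    have ho : {g : ℕ → D | ∀ i ≤ n, g i = d i} ∈ 𝓝 d := by
      have : {g : ℕ → D | ∀ i ≤ n, g i = d i} = ⋂ i ∈ Set.Iic n, {g | g i = d i} := by
        ext; simp
      rw [this]
      refine (biInter_mem (Set.finite_Iic n)).2 fun i _ => ?_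
      exact (isOpen_discrete {d i}).preimage (f := fun g : ℕ → D => g i)
        (continuous_apply i) |>.mem_nhds rfl
    obtain ⟨_, hg, x, rfl⟩ := mem_closure_iff_nhds.1 hd _ ho
    exact ⟨x, hg⟩
  exact ⟨x, funext hx⟩

/-! ### Geodesic rays in trees -/

theorem reachable_induction {N : Type v} {T : SimpleGraph N} {P : N → Prop} {a b : N}
    (h : T.Reachable a b) (ha : P a)
    (step : ∀ t t', T.Reachable a t → T.Adj t t' → P t → P t') : P b := by
  obtain ⟨p⟩ := h
  suffices H : ∀ (c d : N) (q : T.Walk c d), T.Reachable a c → P c → P d from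
    H a b p (SimpleGraph.Reachable.refl a) ha
  intro c d q
  induction q with
  | nil => exact fun _ h => h
  | cons hadj q ih =>
    exact fun hr hc => ih (hr.trans hadj.reachable) (step _ _ hr hadj hc)

/-- The sequence `s` is a geodesic ray of `T` starting at `o`. -/
def IsGeodesicFrom {N : Type v} (T : SimpleGraph N) (o : N) (s : ℕ → N) : Prop :=
  (∀ n, T.Adj (s n) (s (n + 1))) ∧ ∀ n, T.dist o (s n) = n

namespace IsGeodesicFrom

variable {N : Type v} {T : SimpleGraph N} {o : N} {s : ℕ → N}

theorem injective (h : IsGeodesicFrom T o s) : Function.Injective s := fun m n hmn => by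
  rw [← h.2 m, ← h.2 n, hmn]

/-- A geodesic ray as a ray. -/
def toRay (h : IsGeodesicFrom T o s) : Ray T := ⟨s, h.injective, h.1⟩

theorem apply_zero (h : IsGeodesicFrom T o s) (hT : T.Connected) : s 0 = o :=
  ((hT.dist_eq_zero_iff).1 (h.2 0)).symm

end IsGeodesicFrom

section Trees

variable {N : Type v} {T : SimpleGraph N}

/-- Extending shortest walks to `x` and `x'` by the edge to `y` gives two paths from `o` to `y`,
which coincide in a tree. Thus every node has only one parent. -/
theorem eq_of_adj_of_dist_eq (hT : T.IsTree) {o x x' y : N} (hx : T.Adj x y) (hx' : T.Adj x' y)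
    (hd : T.dist o y = T.dist o x + 1) (hd' : T.dist o y = T.dist o x' + 1) : x = x' := by
  have key : ∀ z, T.Adj z y → T.dist o y = T.dist o z + 1 →
      ∃ p : T.Walk o y, p.IsPath ∧ p.penultimate = z := by
    intro z hz hdz
    obtain ⟨p, hp⟩ := hT.connected.exists_walk_length_eq_dist o z
    refine ⟨p.concat hz, SimpleGraph.Walk.isPath_of_length_eq_dist _ ?_, by simp⟩
    rw [SimpleGraph.Walk.length_concat, hp, hdz]
  obtain ⟨p, hp, rfl⟩ := key x hx hd
  obtain ⟨q, hq, rfl⟩ := key x' hx' hd'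
  have : p = q := congrArg Subtype.val
    ((hT.isAcyclic.subsingleton_path o y).elim ⟨p, hp⟩ ⟨q, hq⟩)
  rw [this]

theorem dist_eq_or_of_adj (hT : T.IsTree) (o : N) {x y : N} (h : T.Adj x y) :
    T.dist o y = T.dist o x + 1 ∨ T.dist o x = T.dist o y + 1 := by
  have := hT.dist_ne_of_adj o h
  have := h.diff_dist_adj (u := o)
  omega

/-- In a tree, every ray has a tail which is a tail of a geodesic ray starting at `o`. -/
theorem exists_geodesic_of_ray (hT : T.IsTree) (o : N) (r : Ray T) :
    ∃ s, IsGeodesicFrom T o s ∧ ∃ a b, ∀ n, s (n + a) = r (n + b) := by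
  -- The distance from `o` cannot drop at every step.
  obtain ⟨b, hb⟩ : ∃ b, T.dist o (r (b + 1)) = T.dist o (r b) + 1 := by
    by_contra! hcon
    have hdec : ∀ n, T.dist o (r n) + n = T.dist o (r 0) := fun n => by
      induction n with
      | zero => rfl
      | succ n ih =>
        have := (dist_eq_or_of_adj hT o (r.adj n)).resolve_left (hcon n)
        omega
    have := hdec (T.dist o (r 0) + 1)
    omega
  -- After one step away from `o` the ray never turns back: otherwise the vertices before and after
  -- the turn would both be the parent of the same node, contradicting injectivity.
  have hmono : ∀ n, T.dist o (r (n + b)) = T.dist o (r b) + n ∧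
      T.dist o (r (n + 1 + b)) = T.dist o (r b) + n + 1 := fun n => by
    induction n with
    | zero => simpa [Nat.add_comm] using hb
    | succ n ih =>
      refine ⟨ih.2, ?_⟩
      rcases dist_eq_or_of_adj hT o (r.adj (n + 1 + b)) with h | h
      · rw [show n + 1 + 1 + b = n + 1 + b + 1 by ring, h, ih.2]
        omega
      · have hadj := r.adj (n + b)
        rw [show n + b + 1 = n + 1 + b by ring] at hadj
        have := eq_of_adj_of_dist_eq hT hadj (r.adj (n + 1 + b)).symm
          (by rw [ih.1, ih.2]) h
        have := r.injective this
        omega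
  obtain ⟨p, hp⟩ := hT.connected.exists_walk_length_eq_dist o (r b)
  have hpd : ∀ i ≤ p.length, T.dist o (p.getVert i) = i := fun i hi => by
    have h1 := SimpleGraph.dist_le (p.take i)
    have h2 := SimpleGraph.dist_le (p.drop i)
    have h3 := hT.connected.dist_triangle (u := o) (v := p.getVert i) (w := r b)
    rw [SimpleGraph.Walk.take_length] at h1
    rw [SimpleGraph.Walk.drop_length] at h2
    omega
  refine ⟨fun i => if i < p.length then p.getVert i else r (i - p.length + b), ⟨fun i => ?_,
    fun i => ?_⟩, p.length, b, fun n => by simp⟩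
  · by_cases h : i + 1 < p.length
    · simp only [h, if_true, show i < p.length by omega]
      exact p.adj_getVert_succ (by omega)
    · by_cases h' : i < p.length
      · have hi : i + 1 = p.length := by omega
        have := p.adj_getVert_succ h'
        rw [hi, p.getVert_length] at this
        simpa [h', hi] using this
      · simp only [h, h', if_false]
        rw [show i + 1 - p.length + b = i - p.length + b + 1 by omega]
        exact r.adj _
  · dsimp only
    split_ifs with h
    · exact hpd i h.le
    · rw [(hmono _).1, ← hp]
      omega

end Trees

/-! ### Tree-decompositions of finite adhesion and their boundary -/

namespace TreeDecomposition

variable {V : Type u} {G : SimpleGraph V} (𝒯 : TreeDecomposition.{u, v} G)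

theorem separator_comm (x y : 𝒯.Node) : 𝒯.separator x y = 𝒯.separator y x :=
  Set.inter_comm _ _

theorem self_mem_branch (x y : 𝒯.Node) : y ∈ 𝒯.branch x y := SimpleGraph.Reachable.refl y

variable {𝒯}

theorem mem_branch_of_adj {x y t t' : 𝒯.Node} (ht : t ∈ 𝒯.branch x y) (h : 𝒯.tree.Adj t t')
    (hne : s(t, t') ≠ s(x, y)) : t' ∈ 𝒯.branch x y :=
  SimpleGraph.Reachable.trans ht (SimpleGraph.Adj.reachable (by simp [h, hne]))

theorem notMem_branch {x y t : 𝒯.Node} (hxy : 𝒯.tree.Adj x y) (h : t ∈ 𝒯.branch x y) :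
    t ∉ 𝒯.branch y x := by
  intro h'
  have hb := SimpleGraph.isAcyclic_iff_forall_adj_isBridge.1 𝒯.isTree.isAcyclic hxy
  rw [branch, Set.mem_ofPred_eq, Sym2.eq_swap] at h'
  exact SimpleGraph.isBridge_iff.1 hb (h'.trans h.symm)

theorem mem_branch_or (x y t : 𝒯.Node) : t ∈ 𝒯.branch x y ∨ t ∈ 𝒯.branch y x := by
  refine reachable_induction (P := fun t => t ∈ 𝒯.branch x y ∨ t ∈ 𝒯.branch y x)
    (𝒯.isTree.connected y t) (Or.inl (𝒯.self_mem_branch x y)) ?_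
  intro t t' _ hadj ht
  by_cases he : s(t, t') = s(x, y)
  · rcases Sym2.eq_iff.1 he with ⟨-, rfl⟩ | ⟨-, rfl⟩
    · exact Or.inl (𝒯.self_mem_branch _ _)
    · exact Or.inr (𝒯.self_mem_branch _ _)
  · exact ht.imp (mem_branch_of_adj · hadj he)
      (mem_branch_of_adj · hadj (by rwa [Sym2.eq_swap (a := y)]))

theorem mem_support_of_mem_branch {x y t t' : 𝒯.Node} (hxy : 𝒯.tree.Adj x y)
    (ht : t ∈ 𝒯.branch y x) (ht' : t' ∈ 𝒯.branch x y) (p : 𝒯.tree.Walk t t') :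
    x ∈ p.support ∧ y ∈ p.support := by
  induction p with
  | nil => exact absurd ht (notMem_branch hxy ht')
  | @cons a b c hadj q ih =>
    by_cases he : s(a, b) = s(x, y)
    · rcases Sym2.eq_iff.1 he with ⟨rfl, rfl⟩ | ⟨rfl, rfl⟩
      · simp
      · exact absurd ht (notMem_branch hxy (𝒯.self_mem_branch _ _))
    · have := ih (mem_branch_of_adj ht hadj (by rwa [Sym2.eq_swap (a := y)])) ht'
      simp [this.1, this.2]

theorem mem_side {x y : 𝒯.Node} {w : V} : w ∈ 𝒯.side x y ↔ ∃ t ∈ 𝒯.branch x y, w ∈ 𝒯.part t := by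
  simp [side]

/-- A path between nodes on different sides of `xy` uses both `x` and `y`, so a vertex in parts on
both sides lies in `V_x` and in `V_y`. -/
theorem side_inter_subset {x y : 𝒯.Node} (hxy : 𝒯.tree.Adj x y) :
    𝒯.side x y ∩ 𝒯.side y x ⊆ 𝒯.separator x y := by
  classical
  rintro w ⟨h, h'⟩
  obtain ⟨t', ht', hw'⟩ := mem_side.1 h
  obtain ⟨t, ht, hw⟩ := mem_side.1 h'
  obtain ⟨p, hp⟩ := (𝒯.isTree.connected t t').exists_isPath
  obtain ⟨hx, hy⟩ := mem_support_of_mem_branch hxy ht ht' p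
  exact ⟨𝒯.inter_subset t x t' p hp hx ⟨hw, hw'⟩, 𝒯.inter_subset t y t' p hp hy ⟨hw, hw'⟩⟩

/-- Each edge of `G` lies in a part on one side, so changing sides would require a vertex of the
separator. -/
theorem mem_side_of_joined {x y : 𝒯.Node} (hxy : 𝒯.tree.Adj x y) {w w' : V}
    (hw : w ∈ 𝒯.side x y) (h : Joined G (𝒯.separator x y) w w') : w' ∈ 𝒯.side x y := by
  refine h.induction hw fun a b hab ha _ has => ?_
  obtain ⟨t, hat, hbt⟩ := 𝒯.edge_mem a b hab
  rcases mem_branch_or x y t with ht | ht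
  · exact mem_side.2 ⟨t, ht, hbt⟩
  · exact absurd (side_inter_subset hxy ⟨has, mem_side.2 ⟨t, ht, hat⟩⟩) ha

theorem orients_iff {x y : 𝒯.Node} (hxy : 𝒯.tree.Adj x y) (hfin : (𝒯.separator x y).Finite)
    (r : Ray G) : 𝒯.Orients r.toEnd x y ↔ ∀ᶠ n in atTop, r n ∈ 𝒯.side x y := by
  constructor
  · exact fun h => (eventually_mem_liveComp hfin r).mono fun n hn => h.2 hn
  · refine fun h => ⟨hxy, fun w hw => ?_⟩
    obtain ⟨n, hn, hn'⟩ := (h.and (eventually_mem_liveComp hfin r)).exists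
    exact mem_side_of_joined hxy hn (joined_of_mem_liveComp hfin hn' hw)

theorem orients_or {x y : 𝒯.Node} (hxy : 𝒯.tree.Adj x y) (hfin : (𝒯.separator x y).Finite)
    (ω : GraphEnd G) : 𝒯.Orients ω x y ∨ 𝒯.Orients ω y x := by
  obtain ⟨w, hw⟩ := liveComp_nonempty hfin ω
  have hsub : ∀ w', w' ∈ liveComp G (𝒯.separator x y) ω → Joined G (𝒯.separator x y) w w' :=
    fun w' hw' => joined_of_mem_liveComp hfin hw hw'
  obtain ⟨t, ht⟩ := 𝒯.vertex_mem w
  rcases mem_branch_or x y t with h | h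
  · exact Or.inl ⟨hxy, fun w' hw' => mem_side_of_joined hxy (mem_side.2 ⟨t, h, ht⟩) (hsub w' hw')⟩
  · refine Or.inr ⟨hxy.symm, ?_⟩
    rw [separator_comm] at hsub
    exact fun w' hw' => mem_side_of_joined hxy.symm (mem_side.2 ⟨t, h, ht⟩) (hsub w' hw')

theorem side_mono {x y x' y' : 𝒯.Node} (h : 𝒯.branch x y ⊆ 𝒯.branch x' y') :
    𝒯.side x y ⊆ 𝒯.side x' y' := Set.biUnion_subset_biUnion_left h

/-- Otherwise a ray of `ω` would eventually lie on both sides of `xy`, hence in the finite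
separator. -/
theorem not_orients_of_branch_subset (hfin : 𝒯.FiniteAdhesion) {ω : GraphEnd G}
    {x y x' y' : 𝒯.Node} (h : 𝒯.Orients ω x y) (h' : 𝒯.Orients ω x' y') :
    ¬ 𝒯.branch x' y' ⊆ 𝒯.branch y x := by
  intro hsub
  obtain ⟨r, rfl⟩ := exists_ray ω
  obtain ⟨n, ⟨h1, h2⟩, h3⟩ := (((orients_iff h.1 (hfin _ _ h.1) r).1 h).and
    ((orients_iff h'.1 (hfin _ _ h'.1) r).1 h')).and
      (r.eventually_notMem (hfin _ _ h.1)) |>.exists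
  exact h3 (side_inter_subset h.1 ⟨h1, side_mono hsub h2⟩)

section Geodesic

variable {o : 𝒯.Node} {s : ℕ → 𝒯.Node}

theorem geodesic_mem_branch_of_le (hs : IsGeodesicFrom 𝒯.tree o s) {m n : ℕ} (h : m ≤ n) :
    s m ∈ 𝒯.branch (s (n + 1)) (s n) := by
  induction h using Nat.decreasingInduction with
  | self => exact 𝒯.self_mem_branch _ _
  | of_succ k hk ih =>
    refine mem_branch_of_adj ih (hs.1 k).symm fun he => ?_
    rcases Sym2.eq_iff.1 he with ⟨h1, -⟩ | ⟨-, h1⟩ <;> have := hs.injective h1 <;> omega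

theorem geodesic_mem_branch_of_lt (hs : IsGeodesicFrom 𝒯.tree o s) {m n : ℕ} (h : n < m) :
    s m ∈ 𝒯.branch (s n) (s (n + 1)) := by
  induction m, h using Nat.le_induction with
  | base => exact 𝒯.self_mem_branch _ _
  | succ k hk ih =>
    refine mem_branch_of_adj ih (hs.1 k) fun he => ?_
    rcases Sym2.eq_iff.1 he with ⟨h1, -⟩ | ⟨-, h1⟩ <;> have := hs.injective h1 <;> omega

theorem lt_dist_of_mem_branch (hs : IsGeodesicFrom 𝒯.tree o s) {n : ℕ} {t : 𝒯.Node}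
    (ht : t ∈ 𝒯.branch (s n) (s (n + 1))) : n < 𝒯.tree.dist o t := by
  classical
  obtain ⟨p, hp⟩ := 𝒯.isTree.connected.exists_walk_length_eq_dist o t
  have h0 : o ∈ 𝒯.branch (s (n + 1)) (s n) := by
    have := geodesic_mem_branch_of_le hs (Nat.zero_le n)
    rwa [hs.apply_zero 𝒯.isTree.connected] at this
  have h1 := (mem_support_of_mem_branch (hs.1 n) h0 ht p).2
  have h2 := SimpleGraph.dist_le (p.takeUntil _ h1)
  have h3 := p.length_takeUntil_le_length h1
  rw [hs.2] at h2
  omega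

theorem notMem_geodesic_branch (hs : IsGeodesicFrom 𝒯.tree o s) {n : ℕ} {t : 𝒯.Node}
    (ht : 𝒯.tree.dist o t ≤ n) : t ∉ 𝒯.branch (s n) (s (n + 1)) := fun h =>
  absurd (lt_dist_of_mem_branch hs h) (by omega)

/-- All nodes beyond the `n`-th edge have distance more than `n` from `o`, so `x` is not among them;
this connected set therefore survives the deletion of `xy`. -/
theorem geodesic_branch_subset (hs : IsGeodesicFrom 𝒯.tree o s) {n : ℕ} {x y : 𝒯.Node}
    (hx : 𝒯.tree.dist o x ≤ n) :
    𝒯.branch (s n) (s (n + 1)) ⊆ 𝒯.branch x y ∨ 𝒯.branch (s n) (s (n + 1)) ⊆ 𝒯.branch y x := by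
  have key : ∀ t t', 𝒯.tree.Adj t t' → t ∈ 𝒯.branch (s n) (s (n + 1)) →
      t' ∈ 𝒯.branch (s n) (s (n + 1)) → s(t, t') ≠ s(x, y) := by
    intro t t' _ ht ht' he
    rcases Sym2.eq_iff.1 he with ⟨rfl, -⟩ | ⟨-, rfl⟩
    · exact notMem_geodesic_branch hs hx ht
    · exact notMem_geodesic_branch hs hx ht'
  refine (mem_branch_or x y (s (n + 1))).imp (fun h t ht => ?_) fun h t ht => ?_
  all_goals
    refine reachable_induction ht h fun a b ha hab hmem => ?_
    have hab' := 𝒯.tree.deleteEdges_le _ hab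
    have hne := key a b hab' ha (ha.trans hab.reachable)
    refine mem_branch_of_adj hmem hab' ?_
    first
    | exact hne
    | rwa [Sym2.eq_swap (a := y)]

/-- A vertex in a part near `o` lies beyond an edge of a geodesic ray only if it lies in the
separator induced by that edge. -/
theorem mem_separator_of_mem_side (hs : IsGeodesicFrom 𝒯.tree o s) {n : ℕ} {t : 𝒯.Node} {w : V}
    (hw : w ∈ 𝒯.part t) (ht : 𝒯.tree.dist o t ≤ n) (h : w ∈ 𝒯.side (s n) (s (n + 1))) :
    w ∈ 𝒯.separator (s n) (s (n + 1)) := by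
  refine side_inter_subset (hs.1 n) ⟨h, mem_side.2 ⟨t, ?_, hw⟩⟩
  exact (mem_branch_or _ _ t).resolve_left (notMem_geodesic_branch hs ht)

/-- Finitely many vertices are eventually avoided by the components in which an end lives that is
oriented along a geodesic ray. -/
theorem exists_disjoint_liveComp (hs : IsGeodesicFrom 𝒯.tree o s) {X : Set V} (hX : X.Finite) :
    ∃ n, ∀ ω : GraphEnd G, 𝒯.Orients ω (s n) (s (n + 1)) →
      Disjoint (liveComp G (𝒯.separator (s n) (s (n + 1))) ω) X := by
  choose f hf using 𝒯.vertex_mem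
  obtain ⟨n, hn⟩ := (hX.image fun w => 𝒯.tree.dist o (f w)).bddAbove
  refine ⟨n, fun ω hω => Set.disjoint_left.2 fun w hw hwX => notMem_of_mem_liveComp hw ?_⟩
  exact mem_separator_of_mem_side hs (hf w) (hn (Set.mem_image_of_mem _ hwX)) (hω.2 hw)

theorem exists_geodesic_of_correspondsTo (hfin : 𝒯.FiniteAdhesion) (o : 𝒯.Node) {ω : GraphEnd G}
    {η : GraphEnd 𝒯.tree} (h : 𝒯.CorrespondsTo ω η) :
    ∃ s, IsGeodesicFrom 𝒯.tree o s ∧ ∀ n, 𝒯.Orients ω (s n) (s (n + 1)) := by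
  obtain ⟨r, rfl⟩ := exists_ray η
  obtain ⟨s, hs, a, b, hab⟩ := exists_geodesic_of_ray 𝒯.isTree o r
  refine ⟨s, hs, fun n => (orients_or (hs.1 n) (hfin _ _ (hs.1 n)) ω).resolve_right fun hor => ?_⟩
  obtain ⟨r', hr', N, hN⟩ := h _ _ hor
  -- A tail of `r'` lies behind the edge and a tail of `s` beyond it, so any walk joining them meets
  -- `s n`. Equivalence of the rays, tested with `X = {s n}`, forbids this.
  obtain ⟨M, hM⟩ := (Ray.toEnd_eq_iff.1 hr').joined (Set.finite_singleton (s n))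
  have hj := hM (max N M) (le_max_right _ _) (M + n + 1 + b) (by omega)
  rw [← hab] at hj
  obtain ⟨p, hp⟩ := hj
  exact hp _ (mem_support_of_mem_branch (hs.1 n) (hN _ (le_max_left _ _))
    (geodesic_mem_branch_of_lt hs (by omega)) p).1 rfl

theorem mem_boundary_of_geodesic (hfin : 𝒯.FiniteAdhesion) {ω : GraphEnd G}
    (hs : IsGeodesicFrom 𝒯.tree o s) (h : ∀ n, 𝒯.Orients ω (s n) (s (n + 1))) :
    ω ∈ 𝒯.boundary := by
  refine ⟨hs.toRay.toEnd, fun x y hxy => ⟨hs.toRay, rfl, 𝒯.tree.dist o x + 1, fun n hn => ?_⟩⟩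
  rcases geodesic_branch_subset hs (y := y) (le_refl (𝒯.tree.dist o x)) with hsub | hsub
  · exact hsub (geodesic_mem_branch_of_lt hs hn)
  · exact absurd hsub (not_orients_of_branch_subset hfin hxy (h _))

/-- Where the two rays first diverge, the branch beyond the next edge of `s'` lies behind the next
edge of `s`, and an end cannot be oriented along both. Only the first `n` orientations are needed,
which makes the geodesic locally constant in the end. -/
theorem geodesic_unique (hfin : 𝒯.FiniteAdhesion) {ω : GraphEnd G} {s' : ℕ → 𝒯.Node}
    (hs : IsGeodesicFrom 𝒯.tree o s) (hs' : IsGeodesicFrom 𝒯.tree o s') {n : ℕ}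
    (h : ∀ i < n, 𝒯.Orients ω (s i) (s (i + 1)))
    (h' : ∀ i < n, 𝒯.Orients ω (s' i) (s' (i + 1))) : ∀ i ≤ n, s' i = s i := by
  intro i
  induction i with
  | zero =>
    intro _
    rw [hs.apply_zero 𝒯.isTree.connected, hs'.apply_zero 𝒯.isTree.connected]
  | succ i ih =>
    intro hi
    have hii := ih (by omega)
    by_contra hne
    have hmem : s' (i + 1) ∈ 𝒯.branch (s (i + 1)) (s i) := by
      refine mem_branch_of_adj (𝒯.self_mem_branch _ _) (hii ▸ hs'.1 i) fun he => ?_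
      rcases Sym2.eq_iff.1 he with ⟨h1, -⟩ | ⟨-, h1⟩
      · exact (hs.1 i).ne h1
      · exact hne h1
    rcases geodesic_branch_subset hs' (y := s (i + 1)) (hs.2 i).le with hsub | hsub
    · exact notMem_branch (hs.1 i) (hsub (𝒯.self_mem_branch _ _)) hmem
    · exact not_orients_of_branch_subset hfin (h i hi) (h' i hi) hsub

/-- A decreasing sequence of components of ends along a geodesic ray is realised by an end. -/
theorem exists_end_of_geodesic (hfin : 𝒯.FiniteAdhesion) (hs : IsGeodesicFrom 𝒯.tree o s)
    {C : ℕ → Set V} (ψ : ℕ → GraphEnd G)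
    (hψ : ∀ m, ∀ n ≤ m, 𝒯.Orients (ψ m) (s n) (s (n + 1)))
    (hC : ∀ m, ∀ n ≤ m, liveComp G (𝒯.separator (s n) (s (n + 1))) (ψ m) = C n) :
    ∃ ω, ∀ n, 𝒯.Orients ω (s n) (s (n + 1)) ∧
      liveComp G (𝒯.separator (s n) (s (n + 1))) ω = C n := by
  have hS : ∀ n, (𝒯.separator (s n) (s (n + 1))).Finite := fun n => hfin _ _ (hs.1 n)
  have hside : ∀ n, C n ⊆ 𝒯.side (s n) (s (n + 1)) := fun n => by
    rw [← hC n n le_rfl]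
    exact (hψ n n le_rfl).2
  obtain ⟨r, hr⟩ := exists_ray_of_antitone (G := G) (C := C)
    (fun n => hC n n le_rfl ▸ liveComp_nonempty (hS n) _)
    (antitone_nat_of_succ_le fun n => by
      rw [← hC (n + 1) n n.le_succ, ← hC (n + 1) (n + 1) le_rfl]
      -- A vertex of the `n`-th separator lies in the part of `s n`, so beyond edge `n + 1` it could
      -- only lie in that edge's separator, which the component avoids.
      refine liveComp_subset_of_disjoint (hS _) (Set.disjoint_left.2 fun w hw hw' => ?_)
      refine notMem_of_mem_liveComp hw (mem_separator_of_mem_side hs hw'.1 ?_ ?_)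
      · rw [hs.2]; exact n.le_succ
      · exact (hψ (n + 1) (n + 1) le_rfl).2 hw)
    (fun n u hu w hw => by
      rw [← hC n n le_rfl] at hu hw ⊢
      exact exists_walk_of_mem_liveComp (hS n) hu hw)
    (fun w => by
      obtain ⟨n, hn⟩ := exists_disjoint_liveComp (G := G) hs (Set.finite_singleton w)
      refine ⟨n, fun h => ?_⟩
      have := hn (ψ n) (hψ n n le_rfl)
      rw [hC n n le_rfl] at this
      exact Set.disjoint_left.1 this h rfl)
  refine ⟨r.toEnd, fun n => ⟨(orients_iff (hs.1 n) (hS n) r).2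
    ((hr n).mono fun k hk => hside n hk), ?_⟩⟩
  obtain ⟨k, h1, h2⟩ := ((hr n).and (eventually_mem_liveComp (hS n) r)).exists
  rw [← hC n n le_rfl] at h1 ⊢
  exact liveComp_eq_of_common (hS n) h2 h1

end Geodesic

/-- The boundary of a tree-decomposition of finite adhesion is completely metrizable. -/
theorem isCompletelyMetrizableSpace_boundary (hfin : 𝒯.FiniteAdhesion) :
    TopologicalSpace.IsCompletelyMetrizableSpace 𝒯.boundary := by
  obtain ⟨o⟩ := 𝒯.isTree.connected.nonempty
  have hex : ∀ ω : 𝒯.boundary, ∃ s, IsGeodesicFrom 𝒯.tree o s ∧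
      ∀ n, 𝒯.Orients (ω : GraphEnd G) (s n) (s (n + 1)) := fun ω => by
    obtain ⟨η, hη⟩ := ω.2
    exact exists_geodesic_of_correspondsTo hfin o hη
  choose s hs hor using hex
  let S : 𝒯.boundary → ℕ → Set V := fun ω n => 𝒯.separator (s ω n) (s ω (n + 1))
  have hS : ∀ ω n, (S ω n).Finite := fun ω n => hfin _ _ ((hs ω).1 n)
  refine isCompletelyMetrizableSpace_of_locallyConstant
    (fun n ω => (s ω n, s ω (n + 1), liveComp G (S ω n) (ω : GraphEnd G))) ?_ ?_ ?_
  · intro n ω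
    have hnear : ∀ᶠ φ : 𝒯.boundary in 𝓝 ω, ∀ i ∈ Set.Iic n,
        liveComp G (S ω i) (φ : GraphEnd G) = liveComp G (S ω i) (ω : GraphEnd G) := by
      refine (eventually_all_finite (Set.finite_Iic n)).2 fun i _ => ?_
      exact continuous_subtype_val.continuousAt.eventually
        (GraphEnd.mem_nhds_iff.2 ⟨S ω i, hS ω i, subset_rfl⟩)
    -- Sharing the components at edges `0, …, n` forces `φ` to orient these edges as `ω` does, so
    -- the geodesics agree up to node `n + 1`.
    refine hnear.mono fun φ hφ => ?_
    have heq := geodesic_unique hfin (ω := (φ : GraphEnd G)) (hs ω) (hs φ) (n := n + 1)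
      (fun i hi => ⟨(hs ω).1 i, (hφ i (by simp; omega)).trans_subset (hor ω i).2⟩)
      fun i _ => hor φ i
    have h1 := heq n n.le_succ
    have h2 := heq (n + 1) le_rfl
    simp only [S, h1, h2, Prod.mk.injEq, true_and]
    exact hφ n (by simp)
  · intro ω U hU
    obtain ⟨U', hU', hsub⟩ := mem_nhds_subtype _ _ _ |>.1 hU
    obtain ⟨X, hX, hXU⟩ := GraphEnd.mem_nhds_iff.1 hU'
    obtain ⟨n, hn⟩ := exists_disjoint_liveComp (G := G) (hs ω) hX
    refine ⟨n, fun φ hφ => hsub (hXU ?_)⟩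
    simp only [Prod.mk.injEq] at hφ
    obtain ⟨h1, h2, h3⟩ := hφ
    refine liveComp_eq_of_disjoint (hS ω n) hX (hn ω (hor ω n)) ?_
    rw [← h3]
    simp only [S, h1, h2]
  · intro d hd
    choose ψ hψ using hd
    have hψ' : ∀ m, ∀ n ≤ m, s (ψ m) n = (d n).1 ∧ s (ψ m) (n + 1) = (d n).2.1 ∧
        liveComp G (S (ψ m) n) (ψ m : GraphEnd G) = (d n).2.2 := fun m n h => by
      simp [← hψ m n h]
    have hsucc : ∀ n, (d n).2.1 = (d (n + 1)).1 := fun n => by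
      rw [← (hψ' (n + 1) n n.le_succ).2.1, ← (hψ' (n + 1) (n + 1) le_rfl).1]
    have hgeo : IsGeodesicFrom 𝒯.tree o fun n => (d n).1 := by
      refine ⟨fun n => ?_, fun n => ?_⟩
      · dsimp only
        rw [← hsucc, ← (hψ' n n le_rfl).1, ← (hψ' n n le_rfl).2.1]
        exact (hs _).1 n
      · dsimp only
        rw [← (hψ' n n le_rfl).1]
        exact (hs _).2 n
    -- Consecutive coordinates overlap in a node, so the limit sequence is itself a geodesic ray
    -- with nested components.
    obtain ⟨ω, hω⟩ := exists_end_of_geodesic hfin hgeo (C := fun n => (d n).2.2)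
      (fun m => (ψ m : GraphEnd G))
      (fun m n h => by
        rw [← hsucc, ← (hψ' m n h).1, ← (hψ' m n h).2.1]
        exact hor _ n)
      (fun m n h => by
        rw [← hsucc, ← (hψ' m n h).1, ← (hψ' m n h).2.1]
        exact (hψ' m n h).2.2)
    let ω' : 𝒯.boundary := ⟨ω, mem_boundary_of_geodesic hfin hgeo fun n => (hω n).1⟩
    have heq : ∀ n, s ω' n = (d n).1 := fun n =>
      geodesic_unique hfin (ω := ω) hgeo (hs ω') (n := n) (fun i _ => (hω i).1)
        (fun i _ => hor ω' i) n le_rfl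
    refine ⟨ω', fun n => ?_⟩
    simp only [S, heq]
    rw [(hω n).2, ← hsucc]

end TreeDecomposition

theorem Displayable.isCompletelyMetrizableSpace {V : Type u} {G : SimpleGraph V}
    {Ψ : Set (GraphEnd G)} (h : Displayable.{u, v} G Ψ) :
    TopologicalSpace.IsCompletelyMetrizableSpace Ψ := by
  obtain ⟨𝒯, hfin, rfl, -⟩ := h
  exact TreeDecomposition.isCompletelyMetrizableSpace_boundary hfin

/-! ### Nodes of the binary tree and 0-1 sequences -/

section NormalNodes

theorem normalNode_succ (α : ℕ → Bool) (n : ℕ) :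
    normalNode α (n + 1) = normalNode α n ++ [α n] := by
  simp [normalNode, List.range_succ]

theorem length_normalNode (α : ℕ → Bool) (n : ℕ) : (normalNode α n).length = n := by
  simp [normalNode]

theorem normalNode_injective (α : ℕ → Bool) : Function.Injective (normalNode α) := fun m n h => by
  rw [← length_normalNode α m, h, length_normalNode]

theorem getElem?_normalNode (α : ℕ → Bool) {n i : ℕ} (h : i < n) :
    (normalNode α n)[i]? = some (α i) := by
  simp [normalNode, h]

theorem eq_normalNode {α : ℕ → Bool} {n : ℕ} {t : List Bool} (hlen : t.length = n)
    (h : ∀ i < n, t[i]? = some (α i)) : t = normalNode α n := by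
  refine List.ext_getElem? fun i => ?_
  by_cases hi : i < n
  · rw [h i hi, getElem?_normalNode α hi]
  · rw [List.getElem?_eq_none (by omega),
      List.getElem?_eq_none (by rw [length_normalNode]; omega)]

theorem normalNode_congr {α β : ℕ → Bool} {n : ℕ} (h : ∀ i < n, α i = β i) :
    normalNode α n = normalNode β n :=
  eq_normalNode (length_normalNode α n) fun i hi => by rw [getElem?_normalNode α hi, h i hi]

theorem binaryTree_adj_append (t : List Bool) (b : Bool) : binaryTree.Adj t (t ++ [b]) := by
  simp [binaryTree]

theorem binaryTree_adj {s t : List Bool} (h : binaryTree.Adj s t) :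
    (∃ b, t = s ++ [b]) ∨ ∃ b, s = t ++ [b] := by
  simpa [binaryTree] using h.2

theorem infinite_setOf_flip {α : ℕ → Bool} (h : ¬ ∃ N, ∀ n ≥ N, α n = α N) :
    {m | α (m + 1) ≠ α m}.Infinite := by
  intro hfin
  obtain ⟨N, hN⟩ := hfin.bddAbove
  refine h ⟨N + 1, fun n hn => ?_⟩
  induction n, hn using Nat.le_induction with
  | base => rfl
  | succ n hn ih =>
    rw [← ih]
    by_contra hne
    have : n ≤ N := hN hne
    omega

end NormalNodes

/-! ### The binary tree with tops attached at changes -/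

/-- The tops: countably many for each `0`-`1`-sequence that is not eventually constant. -/
abbrev FlipTop : Type := {α : ℕ → Bool // ¬ ∃ N, ∀ n ≥ N, α n = α N} × ℕ

/-- The binary tree with a top `z` for each element of `FlipTop`, adjacent to those nodes on the
corresponding normal ray whose last two entries differ. -/
def flipGraph : SimpleGraph (List Bool ⊕ FlipTop) where
  Adj
    | .inl s, .inl t => binaryTree.Adj s t
    | .inl s, .inr z => ∃ m, z.1.1 (m + 1) ≠ z.1.1 m ∧ s = normalNode z.1.1 (m + 2)
    | .inr z, .inl s => ∃ m, z.1.1 (m + 1) ≠ z.1.1 m ∧ s = normalNode z.1.1 (m + 2)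
    | .inr _, .inr _ => False
  symm := ⟨by
    rintro (s | z) (t | w) h
    · exact h.symm
    · exact h
    · exact h
    · exact h⟩
  loopless := ⟨by
    rintro (s | z) h
    · exact h.ne rfl
    · exact h⟩

theorem isBinaryTreeWithFatTops_flipGraph : IsBinaryTreeWithFatTops flipGraph := by
  refine ⟨fun s t => Iff.rfl, fun z => ⟨?_, z.1.1, ?_⟩⟩
  · refine ((infinite_setOf_flip z.1.2).image (f := fun m =>
      (Sum.inl (normalNode z.1.1 (m + 2)) : List Bool ⊕ FlipTop)) ?_).mono ?_
    · intro m _ n _ h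
      have := normalNode_injective _ (Sum.inl_injective h)
      omega
    · rintro _ ⟨m, hm, rfl⟩
      exact ⟨m, hm, rfl⟩
  · rintro (s | w) h
    · obtain ⟨m, -, rfl⟩ := h
      exact ⟨m + 2, rfl⟩
    · exact h.elim

/-- The entries of the `0`-`1`-sequence belonging to a vertex of `flipGraph`. -/
def entry : List Bool ⊕ FlipTop → ℕ → Option Bool
  | .inl t, i => t[i]?
  | .inr z, i => some (z.1.1 i)

/-- The vertices of `flipGraph` above the `n`-th node of the normal ray belonging to `α`. -/
def upSet (α : ℕ → Bool) (n : ℕ) : Set (List Bool ⊕ FlipTop) :=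
  {v | ∀ i < n, entry v i = some (α i)}

theorem upSet_antitone (α : ℕ → Bool) : Antitone (upSet α) :=
  fun _ _ h _ hv i hi => hv i (hi.trans_le h)

theorem length_le_of_mem_upSet {α : ℕ → Bool} {n : ℕ} {t : List Bool}
    (h : Sum.inl t ∈ upSet α n) : n ≤ t.length := by
  by_contra! hlt
  have := h _ hlt
  simp [entry] at this

theorem normalNode_mem_upSet (α : ℕ → Bool) {m n : ℕ} (h : n ≤ m) :
    Sum.inl (normalNode α m) ∈ upSet α n :=
  fun _ hi => getElem?_normalNode α (hi.trans_le h)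

theorem upSet_append {α : ℕ → Bool} {n : ℕ} {t : List Bool} {b : Bool} (h : n ≤ t.length) :
    Sum.inl (t ++ [b]) ∈ upSet α n ↔ Sum.inl t ∈ upSet α n := by
  refine forall₂_congr fun i hi => ?_
  simp only [entry]
  rw [List.getElem?_append_left (by omega)]

/-- The neighbours of `upSet α n` outside this set. -/
theorem exists_eq_normalNode_of_adj {α : ℕ → Bool} {n : ℕ} {v w : List Bool ⊕ FlipTop}
    (hv : v ∈ upSet α n) (hw : w ∉ upSet α n) (h : flipGraph.Adj v w) :
    ∃ m < n, w = Sum.inl (normalNode α m) ∧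
      (m + 1 = n ∨ ∃ k, m = k + 2 ∧ α (k + 1) ≠ α k) := by
  match v, w, h with
  | .inl s, .inl t, h =>
    have hlen := length_le_of_mem_upSet hv
    rcases binaryTree_adj h with ⟨b, rfl⟩ | ⟨b, rfl⟩
    · exact absurd ((upSet_append hlen).2 hv) hw
    · have hlt : t.length < n := by
        by_contra! hle
        exact hw ((upSet_append hle).1 hv)
      have hn : t.length + 1 = n := by simp at hlen; omega
      refine ⟨t.length, hlt, congrArg _ (eq_normalNode rfl fun i hi => ?_), Or.inl hn⟩
      have := hv i (by omega)
      simp only [entry] at this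
      rwa [List.getElem?_append_left hi] at this
  -- Here `s` lies on the normal ray of `z` and has length at least `n`, so `z` shares its first `n`
  -- entries and cannot be outside.
  | .inl s, .inr z, ⟨m, _, hs⟩ =>
    refine absurd (fun i hi => ?_) hw
    have hlen := length_le_of_mem_upSet hv
    have := hv i hi
    rw [hs, length_normalNode] at hlen
    simp only [entry, hs] at this ⊢
    rwa [getElem?_normalNode _ (by omega)] at this
  -- The sequence of `z` agrees with `α` below `n`, so a change of it at a node below level `n` is a
  -- change of `α`.
  | .inr z, .inl t, ⟨m, hm, ht⟩ =>
    have hz : ∀ i < n, z.1.1 i = α i := fun i hi => Option.some_injective _ (hv i hi)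
    have hlt : m + 2 < n := by
      by_contra! hle
      refine hw fun i hi => ?_
      simp only [entry]
      rw [ht, getElem?_normalNode _ (by omega), hz i hi]
    refine ⟨m + 2, hlt, ?_, Or.inr ⟨m, rfl, ?_⟩⟩
    · rw [ht, normalNode_congr fun i hi => hz i (by omega)]
    · rwa [← hz _ (by omega), ← hz _ (by omega)]

/-- The nodes below the `n`-th node of a normal ray. -/
def initialNodes (α : ℕ → Bool) (n : ℕ) : Set (List Bool ⊕ FlipTop) :=
  (fun m => Sum.inl (normalNode α m)) '' Set.Iio n

theorem finite_initialNodes (α : ℕ → Bool) (n : ℕ) : (initialNodes α n).Finite :=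
  (Set.finite_Iio n).image _

theorem mem_upSet_of_adj {α : ℕ → Bool} {n : ℕ} {v w : List Bool ⊕ FlipTop}
    (h : flipGraph.Adj v w) (hw : w ∉ initialNodes α n) (hv : v ∈ upSet α n) :
    w ∈ upSet α n := by
  by_contra hw'
  obtain ⟨m, hm, rfl, -⟩ := exists_eq_normalNode_of_adj hv hw' h
  exact hw ⟨m, hm, rfl⟩

/-! ### The ends as 0-1 sequences -/

/-- The ray `r` converges to the normal ray belonging to `α`. -/
def Follows (r : Ray flipGraph) (α : ℕ → Bool) : Prop :=
  ∀ n, ∀ᶠ k in atTop, r k ∈ upSet α n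

theorem finite_setOf_entry_eq_none (i : ℕ) : {v | entry v i = none}.Finite := by
  refine ((List.finite_length_le Bool i).image Sum.inl).subset ?_
  rintro (t | z) h
  · exact ⟨t, by simpa [entry] using h, rfl⟩
  · simp [entry] at h

/-- Once the ray has left the finite set `initialNodes α n` for good, it can no longer leave `upSet
α n`. -/
theorem eventually_mem_upSet_of_frequently {r : Ray flipGraph} {α : ℕ → Bool} {n : ℕ}
    (h : ∃ᶠ k in atTop, r k ∈ upSet α n) : ∀ᶠ k in atTop, r k ∈ upSet α n := by
  obtain ⟨N, hN⟩ := eventually_atTop.1 (r.eventually_notMem (finite_initialNodes α n))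
  obtain ⟨k, hk, hmem⟩ := frequently_atTop.1 h N
  refine eventually_atTop.2 ⟨k, fun l hl => ?_⟩
  induction l, hl using Nat.le_induction with
  | base => exact hmem
  | succ l hl ih => exact mem_upSet_of_adj (r.adj l) (hN _ (by omega)) ih

/-- Compactness: each entry takes values in the finite type `Option Bool`, so it has a limit along a
nonprincipal ultrafilter. The limit is not `none`, since only finitely many vertices lack an `i`-th
entry. -/
theorem exists_follows (r : Ray flipGraph) : ∃ α, Follows r α := by
  have hlim : ∀ i, ∃ b, ∀ᶠ k in (hyperfilter ℕ : Filter ℕ), entry (r k) i = some b := by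
    intro i
    obtain ⟨a, ha⟩ := Ultrafilter.eq_pure_of_finite ((hyperfilter ℕ).map fun k => entry (r k) i)
    have ha' : ∀ᶠ k in (hyperfilter ℕ : Filter ℕ), entry (r k) i = a := by
      have : {a} ∈ (hyperfilter ℕ).map fun k => entry (r k) i := by rw [ha]; rfl
      exact this
    cases a with
    | some b => exact ⟨b, ha'⟩
    | none =>
      have h1 : ∀ᶠ k in (hyperfilter ℕ : Filter ℕ), entry (r k) i ≠ none :=
        (Nat.hyperfilter_le_atTop (r.eventually_notMem (finite_setOf_entry_eq_none i)) :)
      obtain ⟨k, h, h'⟩ := (ha'.and h1).exists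
      exact absurd h h'
  choose α hα using hlim
  refine ⟨α, fun n => eventually_mem_upSet_of_frequently ?_⟩
  have : ∀ᶠ k in (hyperfilter ℕ : Filter ℕ), ∀ i ∈ Set.Iio n, entry (r k) i = some (α i) :=
    (eventually_all_finite (Set.finite_Iio n)).2 fun i _ => hα i
  exact this.frequently.filter_mono Nat.hyperfilter_le_atTop

theorem Follows.of_equivalent {r s : Ray flipGraph} {α : ℕ → Bool} (h : Follows r α)
    (hrs : r.Equivalent s) : Follows s α := by
  intro n
  obtain ⟨N, hN⟩ := hrs.joined (finite_initialNodes α n)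
  obtain ⟨k, hk, hmem⟩ := ((eventually_ge_atTop N).and (h n)).exists
  exact eventually_atTop.2 ⟨N, fun l hl => (hN k hk l hl).induction hmem
    fun u w huw _ hw hu => mem_upSet_of_adj huw hw hu⟩

theorem eq_of_eventually_mem_upSet {r : Ray flipGraph} {α β : ℕ → Bool} {n : ℕ}
    (h : ∀ᶠ k in atTop, r k ∈ upSet α n) (h' : ∀ᶠ k in atTop, r k ∈ upSet β n) :
    ∀ i < n, α i = β i := by
  intro i hi
  obtain ⟨k, h1, h2⟩ := (h.and h').exists
  exact Option.some_injective _ ((h1 i hi).symm.trans (h2 i hi))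

theorem Follows.unique {r : Ray flipGraph} {α β : ℕ → Bool} (h : Follows r α)
    (h' : Follows r β) : α = β :=
  funext fun i => eq_of_eventually_mem_upSet (h (i + 1)) (h' (i + 1)) i i.lt_succ_self

/-- The normal ray belonging to a `0`-`1`-sequence. -/
def normalRay (α : ℕ → Bool) : Ray flipGraph where
  vert n := Sum.inl (normalNode α n)
  injective := Sum.inl_injective.comp (normalNode_injective α)
  adj n := by
    change binaryTree.Adj _ _
    rw [normalNode_succ]
    exact binaryTree_adj_append _ _

theorem follows_normalRay (α : ℕ → Bool) : Follows (normalRay α) α := fun n =>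
  eventually_atTop.2 ⟨n, fun _ hk => normalNode_mem_upSet α hk⟩

theorem exists_endSeq (ω : GraphEnd flipGraph) :
    ∃ α, ∀ r : Ray flipGraph, r.toEnd = ω → Follows r α := by
  obtain ⟨r, rfl⟩ := exists_ray ω
  obtain ⟨α, hα⟩ := exists_follows r
  exact ⟨α, fun s hs => hα.of_equivalent (Ray.toEnd_eq_iff.1 hs.symm)⟩

/-- The `0`-`1`-sequence belonging to an end of `flipGraph`. -/
noncomputable def endSeq (ω : GraphEnd flipGraph) : ℕ → Bool := (exists_endSeq ω).choose

theorem follows_endSeq (r : Ray flipGraph) : Follows r (endSeq r.toEnd) :=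
  (exists_endSeq r.toEnd).choose_spec r rfl

theorem Follows.endSeq_eq {r : Ray flipGraph} {α : ℕ → Bool} (h : Follows r α) :
    endSeq r.toEnd = α := (follows_endSeq r).unique h

theorem exists_length_bound {X : Set (List Bool ⊕ FlipTop)} (hX : X.Finite) :
    ∃ n, ∀ t, Sum.inl t ∈ X → t.length < n := by
  obtain ⟨n, hn⟩ := ((hX.preimage Sum.inl_injective.injOn).image List.length).bddAbove
  exact ⟨n + 1, fun t ht => Nat.lt_succ_of_le (hn ⟨t, ht, rfl⟩)⟩

/-- Descending from `t` to level `n` only passes nodes of length at least `n`, which avoid `X`. -/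
theorem joined_normalNode {X : Set (List Bool ⊕ FlipTop)} {n : ℕ}
    (hn : ∀ t, Sum.inl t ∈ X → t.length < n) {α : ℕ → Bool} (t : List Bool)
    (ht : Sum.inl t ∈ upSet α n) :
    Joined flipGraph X (Sum.inl t) (Sum.inl (normalNode α n)) := by
  have hX : ∀ t : List Bool, n ≤ t.length → (Sum.inl t : List Bool ⊕ FlipTop) ∉ X :=
    fun t h h' => absurd (hn t h') (by omega)
  induction t using List.reverseRecOn with
  | nil =>
    have := length_le_of_mem_upSet ht
    rw [← eq_normalNode (t := []) (α := α) (n := n) (by simp at this; simp [this]) ht]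
    exact Joined.refl (hX _ this)
  | append_singleton t b ih =>
    have hlen := length_le_of_mem_upSet ht
    rcases hlen.lt_or_eq with h | h
    · have hlt : n ≤ t.length := by simp at h; omega
      have hadj : flipGraph.Adj (Sum.inl t) (Sum.inl (t ++ [b])) := binaryTree_adj_append t b
      exact (Joined.of_adj hadj.symm (hX _ hlen) (hX _ hlt)).trans (ih ((upSet_append hlt).1 ht))
    · rw [← eq_normalNode (t := t ++ [b]) (α := α) (n := n) h.symm ht]
      exact Joined.refl (hX _ hlen)

theorem Follows.eventually_joined {X : Set (List Bool ⊕ FlipTop)} (hX : X.Finite) {n : ℕ}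
    (hn : ∀ t, Sum.inl t ∈ X → t.length < n) {α : ℕ → Bool} {r : Ray flipGraph}
    (h : Follows r α) :
    ∀ᶠ k in atTop, Joined flipGraph X (Sum.inl (normalNode α n)) (r k) := by
  obtain ⟨N, hN⟩ := eventually_atTop.1 ((h n).and (r.eventually_notMem hX))
  refine eventually_atTop.2 ⟨N, fun k hk => ?_⟩
  -- Tops are pairwise nonadjacent, so one of two consecutive vertices of the ray is a tree node,
  -- from which one can descend.
  have h1 := hN k hk
  have h2 := hN (k + 1) (by omega)
  have hadj := r.adj k
  have hj := Joined.of_adj hadj h1.2 h2.2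
  generalize r k = v at *
  generalize r (k + 1) = w at *
  match v, w, hadj with
  | .inl s, _, _ => exact (joined_normalNode hn s h1.1).symm
  | .inr z, .inl t, _ => exact (joined_normalNode hn t h2.1).symm.trans hj.symm

theorem normalNode_mem_liveComp {X : Set (List Bool ⊕ FlipTop)} (hX : X.Finite) {n : ℕ}
    (hn : ∀ t, Sum.inl t ∈ X → t.length < n) (ω : GraphEnd flipGraph) :
    Sum.inl (normalNode (endSeq ω) n) ∈ liveComp flipGraph X ω := by
  obtain ⟨r, rfl⟩ := exists_ray ω
  exact (mem_liveComp_iff hX r).2 ((follows_endSeq r).eventually_joined hX hn)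

theorem endSeq_injective : Function.Injective endSeq := fun φ ω h =>
  GraphEnd.ext_of_liveComp fun X hX => by
    obtain ⟨n, hn⟩ := exists_length_bound hX
    exact liveComp_eq_of_common hX (normalNode_mem_liveComp hX hn φ)
      (h ▸ normalNode_mem_liveComp hX hn ω)

theorem endSeq_normalRay (α : ℕ → Bool) : endSeq (normalRay α).toEnd = α :=
  (follows_normalRay α).endSeq_eq

/-- The end space of `flipGraph` carries the topology of the Cantor space. -/
theorem mem_nhds_iff_endSeq {ω : GraphEnd flipGraph} {U : Set (GraphEnd flipGraph)} :
    U ∈ 𝓝 ω ↔ ∃ n, {φ | ∀ i < n, endSeq φ i = endSeq ω i} ⊆ U := by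
  rw [GraphEnd.mem_nhds_iff]
  constructor
  · rintro ⟨X, hX, h⟩
    obtain ⟨n, hn⟩ := exists_length_bound hX
    refine ⟨n, fun φ hφ => h ?_⟩
    have := normalNode_mem_liveComp hX hn φ
    rw [normalNode_congr hφ] at this
    exact liveComp_eq_of_common hX this (normalNode_mem_liveComp hX hn ω)
  · rintro ⟨n, h⟩
    have hX := finite_initialNodes (endSeq ω) n
    refine ⟨initialNodes (endSeq ω) n, hX, fun φ hφ => h ?_⟩
    obtain ⟨r, rfl⟩ := exists_ray φ
    obtain ⟨s, rfl⟩ := exists_ray ω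
    obtain ⟨k, h1, h2⟩ := ((follows_endSeq s n).and (eventually_mem_liveComp hX s)).exists
    refine eq_of_eventually_mem_upSet (follows_endSeq r n) ?_
    refine (eventually_mem_liveComp hX r).mono fun l hl => ?_
    exact (joined_of_mem_liveComp hX h2 (hφ ▸ hl)).induction h1
      fun u w huw _ hw hu => mem_upSet_of_adj huw hw hu

theorem mem_rationalEnds_iff {ω : GraphEnd flipGraph} :
    ω ∈ rationalEnds flipGraph ↔ ∃ N, ∀ n ≥ N, endSeq ω n = endSeq ω N := by
  constructor
  · rintro ⟨α, hα, r, rfl, hr⟩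
    have : Follows r α := fun n =>
      eventually_atTop.2 ⟨n, fun k hk => hr k ▸ normalNode_mem_upSet α hk⟩
    rwa [this.endSeq_eq]
  · exact fun h => ⟨endSeq ω, h, normalRay (endSeq ω),
      endSeq_injective (endSeq_normalRay _), fun _ => rfl⟩

/-! ### Degrees of the ends -/

/-- Only a top with sequence `α` could lie in all these sets, and tops have sequences that are not
eventually constant. -/
theorem exists_notMem_upSet {α : ℕ → Bool} (hα : ∃ N, ∀ n ≥ N, α n = α N)
    (v : List Bool ⊕ FlipTop) : ∃ n, v ∉ upSet α n := by
  match v with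
  | .inl t => exact ⟨t.length + 1, fun h => absurd (length_le_of_mem_upSet h) (by omega)⟩
  | .inr z =>
    by_contra! h
    have : z.1.1 = α := funext fun i => Option.some_injective _ (h (i + 1) i i.lt_succ_self)
    exact z.1.2 (this ▸ hα)

/-- Finitely many disjoint rays of `ω` all start outside `upSet α n` for some `n`, where `α = endSeq
ω`. Each enters it from node `n - 1` or from a node `j + 2` with a change of `α` at `j < N`, and
disjoint rays use different nodes. This allows `1 + (N + 2)` rays. -/
theorem endDegree_le_of_endSeq {ω : GraphEnd flipGraph} {N : ℕ}
    (hN : ∀ n ≥ N, endSeq ω n = endSeq ω N) : endDegree ω ≤ (N + 3 : ℕ) := by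
  classical
  refine ciSup_le' fun F => Cardinal.mk_le_iff_forall_finset_subset_card_le.2 fun s hs => ?_
  obtain ⟨F, hF, hdisj⟩ := F
  have hlevel : ∃ n, ∀ r ∈ s, r 0 ∉ upSet (endSeq ω) n := by
    choose f hf using exists_notMem_upSet (α := endSeq ω) ⟨N, hN⟩
    obtain ⟨n, hn⟩ := (s.finite_toSet.image fun r => f (r 0)).bddAbove
    exact ⟨n, fun r hr h => hf (r 0) (upSet_antitone _ (hn ⟨r, hr, rfl⟩) h)⟩
  obtain ⟨n, hn⟩ := hlevel
  have hhit : ∀ r ∈ s, ∃ m ∈ insert (n - 1) (Finset.range (N + 2)),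
      Sum.inl (normalNode (endSeq ω) m) ∈ Set.range r := by
    intro r hr
    have hω : r.toEnd = ω := hF r (hs hr)
    have hfol : Follows r (endSeq ω) := hω ▸ follows_endSeq r
    have hex := (hfol n).exists
    -- The first vertex inside has a predecessor outside, which is the node sought.
    have h0 : Nat.find hex ≠ 0 := fun h0 => hn r hr (h0 ▸ Nat.find_spec hex)
    obtain ⟨k, hk⟩ := Nat.exists_eq_succ_of_ne_zero h0
    have hspec := Nat.find_spec hex
    rw [hk] at hspec
    obtain ⟨m, hm, heq, hcase⟩ := exists_eq_normalNode_of_adj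
      hspec (Nat.find_min hex (m := k) (by omega)) (r.adj k).symm
    refine ⟨m, ?_, k, heq⟩
    rcases hcase with h | ⟨j, rfl, hj⟩
    · simp; omega
    · have : j < N := by
        by_contra! hle
        exact hj ((hN (j + 1) (by omega)).trans (hN j hle).symm)
      simp; omega
  choose! f hf hfr using hhit
  refine (Finset.card_le_card_of_injOn f hf fun r hr r' hr' h => ?_).trans
    ((Finset.card_insert_le _ _).trans (by simp))
  by_contra hne
  refine Set.disjoint_left.1 (hdisj (hs hr) (hs hr') hne) (hfr r hr) ?_
  rw [h]
  exact hfr r' hr'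

/-- The infinitely many changes and the infinitely many tops of `endSeq ω` span a complete bipartite
graph, which splits into infinitely many disjoint rays. -/
theorem aleph0_le_endDegree {ω : GraphEnd flipGraph}
    (hω : ¬ ∃ N, ∀ n ≥ N, endSeq ω n = endSeq ω N) : Cardinal.aleph0 ≤ endDegree ω := by
  set α := endSeq ω with hα
  let p : ℕ ↪ {m | α (m + 1) ≠ α m} := (infinite_setOf_flip hω).natEmbedding
  let node : ℕ → List Bool ⊕ FlipTop := fun i => Sum.inl (normalNode α ((p i : ℕ) + 2))
  let top : ℕ → List Bool ⊕ FlipTop := fun i => Sum.inr (⟨α, hω⟩, i)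
  have hnode : Function.Injective node := fun i j h => by
    have := normalNode_injective _ (Sum.inl_injective h)
    exact p.injective (Subtype.ext (by omega))
  have htop : Function.Injective top := fun i j h => (Prod.ext_iff.1 (Sum.inr_injective h)).2
  have hadj : ∀ i j, flipGraph.Adj (node i) (top j) := fun i j => ⟨p i, (p i).2, rfl⟩
  -- The `j`-th ray alternates between nodes and tops; the pairing function reserves disjoint index
  -- sets for different `j`.
  let f : ℕ → ℕ → List Bool ⊕ FlipTop := fun j k =>
    if k % 2 = 0 then node (Nat.pair j (k / 2)) else top (Nat.pair j (k / 2))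
  have hf : ∀ j k j' k', f j k = f j' k' → j = j' ∧ k = k' := by
    intro j k j' k' h
    simp only [f] at h
    split_ifs at h with h1 h2 h2
    · have := Nat.pair_eq_pair.1 (hnode h)
      omega
    · have := Nat.pair_eq_pair.1 (htop h)
      omega
  let R : ℕ → Ray flipGraph := fun j => ⟨f j, fun k k' h => (hf _ _ _ _ h).2, fun k => by
    simp only [f]
    split_ifs with h1 h2 h2
    · omega
    · exact hadj _ _
    · exact (hadj _ _).symm
    · omega⟩
  have hdisj : ∀ i j, i ≠ j → Disjoint (Set.range (R i)) (Set.range (R j)) := by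
    intro i j hij
    refine Set.disjoint_left.2 ?_
    rintro _ ⟨k, rfl⟩ ⟨k', h⟩
    exact hij (hf _ _ _ _ h).1.symm
  have hR : Function.Injective R := fun i j h => by
    by_contra hne
    refine Set.disjoint_left.1 (hdisj i j hne) ⟨0, rfl⟩ (h ▸ ⟨0, rfl⟩)
  have hend : ∀ j, (R j).toEnd = ω := fun j => endSeq_injective <| by
    refine Follows.endSeq_eq fun n => ?_
    -- The tops carry the sequence `α` itself and so lie in every `upSet α n`; the nodes do so once
    -- they avoid the initial ones.
    refine ((R j).eventually_notMem (finite_initialNodes α n)).mono fun k hk => ?_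
    change f j k ∉ _ at hk
    change f j k ∈ _
    simp only [f] at hk ⊢
    split_ifs at hk ⊢ with h
    · refine normalNode_mem_upSet α ?_
      by_contra! hlt
      exact hk ⟨_, hlt, rfl⟩
    · exact fun i _ => rfl
  have hle := le_ciSup (f := fun F : {F : Set (Ray flipGraph) //
    (∀ r ∈ F, r.toEnd = ω) ∧ F.Pairwise fun r s => Disjoint (Set.range r) (Set.range s)} =>
      Cardinal.mk F.1) Cardinal.bddAbove_of_small ⟨Set.range R, by rintro _ ⟨j, rfl⟩; exact hend j, by
        rintro _ ⟨i, rfl⟩ _ ⟨j, rfl⟩ hne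
        exact hdisj i j fun h => hne (h ▸ rfl)⟩
  refine le_trans ?_ hle
  rw [Cardinal.mk_range_eq R hR, Cardinal.mk_nat]

theorem thinEnds_flipGraph : thinEnds flipGraph = rationalEnds flipGraph := by
  ext ω
  rw [mem_rationalEnds_iff]
  constructor
  · intro h
    by_contra hω
    exact absurd h (not_lt.2 (aleph0_le_endDegree hω))
  · rintro ⟨N, hN⟩
    exact (endDegree_le_of_endSeq hN).trans_lt Cardinal.natCast_lt_aleph0

/-! ### Recognising the rationals -/

section Rationals

theorem countable_setOf_eventually_eq (p : ℕ → Bool) :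
    {α : ℕ → Bool | ∃ N, ∀ n ≥ N, α n = p n}.Countable := by
  have hN : ∀ α : {α : ℕ → Bool | ∃ N, ∀ n ≥ N, α n = p n}, ∃ N, ∀ n ≥ N, α.1 n = p n :=
    fun α => α.2
  choose N hN using hN
  -- The initial segment of length `N α` also records `N α`, and beyond it the sequence is given by
  -- `p`.
  have hinj : Function.Injective fun α => normalNode α.1 (N α) := fun α β h => by
    dsimp only at h
    have hlen : N α = N β := by rw [← length_normalNode α.1 (N α), h, length_normalNode]
    refine Subtype.ext (funext fun i => ?_)
    rcases lt_or_ge i (N α) with hi | hi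
    · have h1 := getElem?_normalNode α.1 hi
      rw [h, getElem?_normalNode β.1 (hlen ▸ hi)] at h1
      exact (Option.some_injective _ h1).symm
    · rw [hN α i hi, hN β i (hlen ▸ hi)]
  exact hinj.countable

variable {Y : Type u} {e : Y → ℕ → Bool}

/-- A space of `0`-`1`-sequences which consists of the sequences that are eventually equal to
`0, 1, 0, 1, …` is homeomorphic to the rationals. -/
theorem nonempty_homeomorph_rat_of_alternating [TopologicalSpace Y] (he : Function.Injective e)
    (hrange : Set.range e = {b | ∃ N, ∀ n ≥ N, b n = decide (n % 2 = 1)})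
    (hnhds : ∀ x, ∀ U : Set Y, U ∈ 𝓝 x ↔ ∃ n, {y | ∀ i < n, e y i = e x i} ⊆ U) :
    Nonempty (Y ≃ₜ ℚ) := by
  let : LinearOrder Y := LinearOrder.lift' (fun y => toLex (e y)) (toLex.injective.comp he)
  have hlt : ∀ x y : Y, x < y ↔ ∃ i, (∀ j < i, e x j = e y j) ∧ e x i = false ∧ e y i = true := by
    intro x y
    have : x < y ↔ ∃ i, (∀ j < i, e x j = e y j) ∧ e x i < e y i := Iff.rfl
    simpa only [Bool.lt_iff] using this
  have hpar : ∀ y : Y, ∃ N, ∀ n ≥ N, e y n = decide (n % 2 = 1) := fun y => by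
    have : e y ∈ Set.range e := ⟨y, rfl⟩
    rwa [hrange] at this
  have hmodify : ∀ x : Y, ∀ n c, ∃ y, (∀ i < n, e y i = e x i) ∧ e y n = c := by
    intro x n c
    have : (fun i => if i < n then e x i else if i = n then c else decide (i % 2 = 1)) ∈
        Set.range e := by
      rw [hrange]
      exact ⟨n + 1, fun i hi => by
        dsimp only
        rw [if_neg (by omega), if_neg (by omega)]⟩
    obtain ⟨y, hy⟩ := this
    exact ⟨y, fun i hi => by simp [hy, hi], by simp [hy]⟩
  -- Both values occur arbitrarily late, so a sequence can be lowered or raised without touching its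
  -- first `n` entries. Density and the absence of endpoints both rest on this.
  have hex : ∀ x : Y, ∀ n c, ∃ m ≥ n, e x m = c := by
    intro x n c
    obtain ⟨N, hN⟩ := hpar x
    cases c with
    | false => exact ⟨2 * (n + N), by omega, by rw [hN _ (by omega)]; simp⟩
    | true => exact ⟨2 * (n + N) + 1, by omega, by rw [hN _ (by omega)]; simp⟩
  have hbelow : ∀ x : Y, ∀ n, ∃ y < x, ∀ i < n, e y i = e x i := by
    intro x n
    obtain ⟨m, hm, hxm⟩ := hex x n true
    obtain ⟨y, hy, hym⟩ := hmodify x m false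
    exact ⟨y, (hlt _ _).2 ⟨m, hy, hym, hxm⟩, fun i hi => hy i (hi.trans_le hm)⟩
  have habove : ∀ x : Y, ∀ n, ∃ y, x < y ∧ ∀ i < n, e y i = e x i := by
    intro x n
    obtain ⟨m, hm, hxm⟩ := hex x n false
    obtain ⟨y, hy, hym⟩ := hmodify x m true
    exact ⟨y, (hlt _ _).2 ⟨m, fun i hi => (hy i hi).symm, hxm, hym⟩,
      fun i hi => hy i (hi.trans_le hm)⟩
  have hright : ∀ x y : Y, x < y → ∃ n, ∀ z, (∀ i < n, e z i = e x i) → z < y := by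
    intro x y hxy
    obtain ⟨i, h1, h2, h3⟩ := (hlt _ _).1 hxy
    exact ⟨i + 1, fun z hz => (hlt _ _).2 ⟨i, fun j hj => (hz j (by omega)).trans (h1 j hj),
      (hz i i.lt_succ_self).trans h2, h3⟩⟩
  have hleft : ∀ x y : Y, y < x → ∃ n, ∀ z, (∀ i < n, e z i = e x i) → y < z := by
    intro x y hxy
    obtain ⟨i, h1, h2, h3⟩ := (hlt _ _).1 hxy
    exact ⟨i + 1, fun z hz => (hlt _ _).2 ⟨i, fun j hj => (h1 j hj).trans (hz j (by omega)).symm,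
      h2, (hz i i.lt_succ_self).trans h3⟩⟩
  -- Cylinders are order-convex. Since they also contain points on either side of `x`, they contain
  -- open intervals around `x`; with `hright` and `hleft` the two topologies agree.
  have hconvex : ∀ x y z w : Y, ∀ n, (∀ i < n, e y i = e x i) → (∀ i < n, e w i = e x i) →
      y < z → z < w → ∀ i < n, e z i = e x i := by
    intro x y z w n hy hw hyz hzw i
    induction i using Nat.strong_induction_on with
    | _ i ih =>
      intro hi
      obtain ⟨j, h1, h2, h3⟩ := (hlt _ _).1 hyz
      obtain ⟨k, h4, h5, h6⟩ := (hlt _ _).1 hzw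
      have hj : ¬ j < i := fun hj => by
        have := ih j hj (by omega)
        rw [h3, ← hy j (by omega), h2] at this
        exact absurd this (by simp)
      have hk : ¬ k < i := fun hk => by
        have := ih k hk (by omega)
        rw [h5, ← hw k (by omega), h6] at this
        exact absurd this (by simp)
      rcases Nat.lt_or_ge i j with h | h
      · rw [← h1 i h, hy i hi]
      · rcases Nat.lt_or_ge i k with h' | h'
        · rw [h4 i h', hw i hi]
        · obtain rfl : i = j := by omega
          obtain rfl : i = k := by omega
          rw [h3] at h5
          exact absurd h5 (by simp)
  have : Countable Y := by
    have h := countable_setOf_eventually_eq fun n => decide (n % 2 = 1)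
    rw [← hrange] at h
    have : Countable (Set.range e) := h
    exact (Equiv.ofInjective e he).injective.countable
  have : Nonempty Y := by
    have : (fun n => decide (n % 2 = 1)) ∈ Set.range e := by
      rw [hrange]
      exact ⟨0, fun _ _ => rfl⟩
    exact ⟨this.choose⟩
  have : DenselyOrdered Y := ⟨fun x y hxy => by
    obtain ⟨n, hn⟩ := hright x y hxy
    obtain ⟨z, hz, hzn⟩ := habove x n
    exact ⟨z, hz, hn z hzn⟩⟩
  have : NoMinOrder Y := ⟨fun x => (hbelow x 0).imp fun _ h => h.1⟩
  have : NoMaxOrder Y := ⟨fun x => (habove x 0).imp fun _ h => h.1⟩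
  obtain ⟨f⟩ := Order.iso_of_countable_dense Y ℚ
  refine ⟨⟨f.toEquiv, ?_, ?_⟩⟩
  · refine continuous_iff_continuousAt.2 fun x U hU => ?_
    obtain ⟨a, b, ⟨ha, hb⟩, hab⟩ := mem_nhds_iff_exists_Ioo_subset.1 hU
    obtain ⟨m, hm⟩ := hleft x (f.symm a) (f.symm_apply_lt.2 ha)
    obtain ⟨n, hn⟩ := hright x (f.symm b) (f.lt_symm_apply.2 hb)
    refine (hnhds x _).2 ⟨max m n, fun y hy => hab ⟨?_, ?_⟩⟩
    · exact f.symm_apply_lt.1 (hm y fun i hi => hy i (by omega))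
    · exact f.lt_symm_apply.1 (hn y fun i hi => hy i (by omega))
  · refine continuous_iff_continuousAt.2 fun q U hU => ?_
    obtain ⟨n, hn⟩ := (hnhds _ _).1 hU
    obtain ⟨y, hy, hyn⟩ := hbelow (f.symm q) n
    obtain ⟨w, hw, hwn⟩ := habove (f.symm q) n
    refine mem_map.2 (mem_of_superset
      (Ioo_mem_nhds (f.lt_symm_apply.1 hy) (f.symm_apply_lt.1 hw)) fun p hp => ?_)
    exact hn (hconvex _ y _ w n hyn hwn (f.lt_symm_apply.2 hp.1) (f.symm_apply_lt.2 hp.2))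

/-- The sequence of changes of a `0`-`1`-sequence, with every other entry negated. -/
def flipCode (α : ℕ → Bool) : ℕ → Bool
  | 0 => α 0
  | n + 1 => (α (n + 1) ^^ α n) ^^ decide ((n + 1) % 2 = 1)

/-- Initial segments of a sequence and of its code determine each other, so recoding preserves
cylinders and hence the topology. -/
theorem flipCode_agree_iff {α β : ℕ → Bool} {n : ℕ} :
    (∀ i < n, flipCode α i = flipCode β i) ↔ ∀ i < n, α i = β i := by
  constructor
  · intro h i
    induction i with
    | zero => exact h 0
    | succ i ih =>
      intro hi
      have h1 := h (i + 1) hi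
      have h2 := ih (by omega)
      simpa [flipCode, h2] using h1
  · intro h i hi
    cases i with
    | zero => exact h 0 hi
    | succ i => simp only [flipCode, h (i + 1) hi, h i (by omega)]

theorem flipCode_injective : Function.Injective flipCode := fun _ _ h =>
  funext fun i => (flipCode_agree_iff (n := i + 1)).1 (fun j _ => congrFun h j) i i.lt_succ_self

theorem flipCode_surjective : Function.Surjective flipCode := fun b => by
  refine ⟨fun n => Nat.rec (b 0) (fun n a => (b (n + 1) ^^ decide ((n + 1) % 2 = 1)) ^^ a) n,
    funext fun n => ?_⟩
  cases n with
  | zero => rfl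
  | succ n => simp [flipCode]

theorem eventually_flipCode_iff {α : ℕ → Bool} :
    (∃ N, ∀ n ≥ N, flipCode α n = decide (n % 2 = 1)) ↔ ∃ N, ∀ n ≥ N, α n = α N := by
  have key : ∀ n, flipCode α (n + 1) = decide ((n + 1) % 2 = 1) ↔ α (n + 1) = α n := fun n => by
    simp only [flipCode]
    cases α (n + 1) <;> cases α n <;> simp
  constructor
  · rintro ⟨N, hN⟩
    refine ⟨N, fun n hn => ?_⟩
    induction n, hn using Nat.le_induction with
    | base => rfl
    | succ n hn ih => rw [(key n).1 (hN _ (by omega)), ih]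
  · rintro ⟨N, hN⟩
    refine ⟨N + 1, fun n hn => ?_⟩
    obtain ⟨m, rfl⟩ : ∃ m, n = m + 1 := ⟨n - 1, by omega⟩
    exact (key m).2 ((hN _ (by omega)).trans (hN m (by omega)).symm)

/-- Eventually constant sequences have lexicographic jumps such as `0111…` and `1000…`, so they are
first recoded by `flipCode` as eventually alternating ones. -/
theorem nonempty_homeomorph_rat_of_eventuallyConst [TopologicalSpace Y]
    (he : Function.Injective e) (hrange : Set.range e = {b | ∃ N, ∀ n ≥ N, b n = b N})
    (hnhds : ∀ x, ∀ U : Set Y, U ∈ 𝓝 x ↔ ∃ n, {y | ∀ i < n, e y i = e x i} ⊆ U) :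
    Nonempty (Y ≃ₜ ℚ) := by
  refine nonempty_homeomorph_rat_of_alternating (e := flipCode ∘ e) (flipCode_injective.comp he)
    ?_ ?_
  · rw [Set.range_comp, hrange]
    ext b
    obtain ⟨α, rfl⟩ := flipCode_surjective b
    rw [flipCode_injective.mem_set_image]
    exact eventually_flipCode_iff.symm
  · intro x U
    rw [hnhds]
    simp only [Function.comp_apply, flipCode_agree_iff]

/-- By Baire's theorem, one of the countably many closed singletons covering the space has nonempty
interior. -/
theorem exists_isOpen_singleton_of_countable {Y : Type*} [TopologicalSpace Y] [Countable Y]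
    [Nonempty Y] [TopologicalSpace.IsCompletelyMetrizableSpace Y] : ∃ y : Y, IsOpen {y} := by
  let := TopologicalSpace.upgradeIsCompletelyMetrizable Y
  obtain ⟨y, hy⟩ := nonempty_interior_of_iUnion_of_closed (f := fun y : Y => {y})
    (fun y => isClosed_singleton) (Set.iUnion_of_singleton Y)
  refine ⟨y, ?_⟩
  rw [← (interior_subset (s := {y})).antisymm (Set.singleton_subset_iff.2 ?_)]
  · exact isOpen_interior
  · obtain ⟨z, hz⟩ := hy
    exact Set.mem_singleton_iff.1 (interior_subset hz) ▸ hz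

theorem not_isCompletelyMetrizableSpace_rat :
    ¬ TopologicalSpace.IsCompletelyMetrizableSpace ℚ := fun _ => by
  obtain ⟨q, hq⟩ := exists_isOpen_singleton_of_countable (Y := ℚ)
  exact not_isOpen_singleton q hq

end Rationals

/-! ### The thin ends of the example -/

theorem uncountable_flipTop : Uncountable FlipTop := by
  refine ⟨fun _ => ?_⟩
  have h1 : {α : ℕ → Bool | ∃ N, ∀ n ≥ N, α n = α N}.Countable := by
    have := (countable_setOf_eventually_eq fun _ => true).union
      (countable_setOf_eventually_eq fun _ => false)
    refine this.mono ?_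
    rintro α ⟨N, hN⟩
    cases h : α N with
    | true => exact Or.inl ⟨N, fun n hn => (hN n hn).trans h⟩
    | false => exact Or.inr ⟨N, fun n hn => (hN n hn).trans h⟩
  have h2 : {α : ℕ → Bool | ∃ N, ∀ n ≥ N, α n = α N}ᶜ.Countable := by
    have hinj : Function.Injective fun α : {α : ℕ → Bool // ¬ ∃ N, ∀ n ≥ N, α n = α N} =>
      ((α, 0) : FlipTop) := fun α β h => (Prod.ext_iff.1 h).1
    exact hinj.countable
  have h3 := h1.union h2
  rw [Set.union_compl_self, Set.countable_univ_iff] at h3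
  -- Countably many tops would make all of `ℕ → Bool` countable, against Cantor's theorem for sets
  -- of naturals.
  obtain ⟨g, hg⟩ := exists_injective_nat (ℕ → Bool)
  classical
  refine Function.cantor_injective (fun s : Set ℕ => g fun n => decide (n ∈ s)) fun s t h => ?_
  ext n
  simpa using congrFun (hg h) n

theorem nonempty_thinEnds_homeomorph_rat : Nonempty (thinEnds flipGraph ≃ₜ ℚ) := by
  rw [thinEnds_flipGraph]
  refine nonempty_homeomorph_rat_of_eventuallyConst (e := fun ω => endSeq ω.1)
    (fun _ _ h => Subtype.ext (endSeq_injective h)) ?_ ?_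
  · ext α
    constructor
    · rintro ⟨ω, rfl⟩
      exact mem_rationalEnds_iff.1 ω.2
    · intro h
      have hα := endSeq_normalRay α
      exact ⟨⟨(normalRay α).toEnd, mem_rationalEnds_iff.2 (hα.symm ▸ h)⟩, hα⟩
  · intro x U
    rw [mem_nhds_subtype]
    constructor
    · rintro ⟨W, hW, hWU⟩
      obtain ⟨n, hn⟩ := mem_nhds_iff_endSeq.1 hW
      exact ⟨n, fun y hy => hWU (hn hy)⟩
    · rintro ⟨n, hn⟩
      exact ⟨_, mem_nhds_iff_endSeq.2 ⟨n, subset_rfl⟩, fun y hy => hn hy⟩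

theorem not_isCompletelyMetrizableSpace_thinEnds :
    ¬ TopologicalSpace.IsCompletelyMetrizableSpace (thinEnds flipGraph) := fun _ => by
  obtain ⟨f⟩ := nonempty_thinEnds_homeomorph_rat
  exact not_isCompletelyMetrizableSpace_rat
    f.symm.isClosedEmbedding.IsCompletelyMetrizableSpace

end EndSpace

theorem mainTheorem11 :
    (∃ (Z : Type) (G : SimpleGraph (List Bool ⊕ Z)),
      Uncountable Z ∧ EndSpace.IsBinaryTreeWithFatTops G ∧
      EndSpace.thinEnds G = EndSpace.rationalEnds G ∧
      Nonempty (EndSpace.thinEnds G ≃ₜ ℚ) ∧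
      ¬ TopologicalSpace.IsCompletelyMetrizableSpace (EndSpace.thinEnds G) ∧
      ¬ EndSpace.Displayable.{0, v} G (EndSpace.thinEnds G)) ∧
    (∀ (V : Type u) (G : SimpleGraph V) (Ψ : Set (EndSpace.GraphEnd G)),
      EndSpace.Displayable.{u, v} G Ψ → TopologicalSpace.IsCompletelyMetrizableSpace Ψ) :=
  ⟨⟨EndSpace.FlipTop, EndSpace.flipGraph, EndSpace.uncountable_flipTop,
    EndSpace.isBinaryTreeWithFatTops_flipGraph, EndSpace.thinEnds_flipGraph,
    EndSpace.nonempty_thinEnds_homeomorph_rat, EndSpace.not_isCompletelyMetrizableSpace_thinEnds,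
    fun h => EndSpace.not_isCompletelyMetrizableSpace_thinEnds h.isCompletelyMetrizableSpace⟩,
    fun _ _ _ h => h.isCompletelyMetrizableSpace⟩
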